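/- **Problem.** The vertex set is finite and fixed, with an arbitrary initial vertex order (a total order, $x<y$ meaning that $x$ precedes $y$). There are no arcs initially. Arcs are added one at a time (parallel arcs are allowed), and after each addition either the vertex order is a topological order, or a cycle is reported and the process stops. **Algorithm (compatible search with a soft threshold).** To add an arc $(v,w)$: if $v<w$, nothing else is done; if $v=w$, report a cycle. If $v>w$, search as follows. A vertex is *forward* if it is $w$ or has been reached by forward traversals, *backward* if it is $v$ or has been reached by backward traversals. Initialize $l=w$, $h=v$, let $s$ be any vertex with $w\le s\le v$, $A=\{w\}$, $C=\{v\}$, $B=D=X=Y=\emptyset$. Until $A\cup B$ or $C\cup D$ is empty, repeat an applicable case, trying the cases in the order of their numbers (f and b versions in either order): - 1f. $A=\emptyset$: move all of $B$ to $A$, set $l=s$, choose a new soft threshold $s\in A$, then set $s=\min\{s,h\}$. 1b. $C=\emptyset$: move all of $D$ to $C$, set $h=s$, choose a new soft threshold $s\in C$, then set $s=\max\{s,l\}$. - Otherwise choose any $u\in A$ and $z\in C$. 2f. $u\ge h$: delete $u$ from $A$. 2b. $z\le l$: delete $z$ from $C$. - 3f. $\max\{z,s\}\le u<h$: move $u$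 from $A$ to $B$. 3b. $l<z\le\min\{u,s\}$: move $z$ from $C$ to $D$. - 4f. All arcs out of $u$ are traversed: move $u$ from $A$ to $X$. 4b. All arcs into $z$ are traversed: move $z$ from $C$ to $Y$. - 5. Otherwise traverse an untraversed arc $(u,x)$ forward and an untraversed arc $(y,z)$ backward. If $x$ is backward, or $y$ is forward, or $x=y$, stop and report a cycle. Otherwise, if $x$ was unreached it becomes forward and joins $A$; if $y$ was unreached it becomes backward and joins $C$. If no cycle was reported, set $s=h$ if $A\cup B=\emptyset$ and $s=l$ otherwise; remove from $X$ all vertices $\ge s$ and from $Y$ all vertices $\le s$; let $O_X$, $O_Y$ be any topological orders of the subgraphs induced by $X$, $Y$; delete $X\cup Y$ from the vertex order and reinsert it as $O_Y$ followed by $O_X$, just after $s$ if $s$ is not forward, or just before $s$ if $s$ is not backward (either, if both hold). **Time.** Comparing two vertices in the vertex order, deleting or reinserting a vertex there, moving a vertex between sets, traversing an arc, and each case take $O(1)$ time (that is, one unit per such operation); choosing a soft threshold from a set of $g$ vertices takes time $O(g)$; topologically ordering $X$ and $Y$ takes time linear in the number of vertices of the two sets plus the number of arcs out of $X$ and into $Y$;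 reporting a cycle found by a search takes time linear in the number of vertices reached. Initialization, before the first arc addition, is not counted. An element $a$ of a totally ordered set of $g$ elements is an *$\epsilon$-approximate median* of it if at least $\epsilon g$ of the elements are $\le a$ and at least $\epsilon g$ of them are $\ge a$. **Theorem.** However all the choices left open are made, a search in progress can always be continued by some case or by the final reordering. The amortized time is $O(m^{1/2})$ per arc addition, where $m$ is the number of arcs added: 1. (Worst case.) For every $\epsilon>0$ there is a constant $K$, depending only on $\epsilon$, such that if each soft threshold chosen in Cases 1f and 1b is an $\epsilon$-approximate median of the set from which it is chosen, then at every moment of every execution, with $m$ the number of arcs added so far, the total time spent so far is at most $K m^{1/2}\cdot m$. 2. (Expected.) There is an absolute constant $K$ such that if each soft threshold chosen in Cases 1f and 1b is drawn uniformly at random, by a fresh random choice, from the set from which it is chosen, then for every execution, cut off after finitely many steps, that adds at most $m$ arcs, the expected total time is at most $K m^{1/2}\cdot m$; here the arcs added, all other choices and the moment of the cut-off may depend on the random choices made so far. -/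

import Mathlib

universe u

namespace IncTopo

/-! The vertices are listed in the current vertex order `L`; a vertex precedes another one
when its position in `L` is smaller.  Arcs are listed in the order of their addition, and an arc
is identified by its index in that list, so parallel arcs are allowed. -/

/-- `x < y` in the vertex order `L`. -/
def Lt {V : Type*} [DecidableEq V] (L : List V) (x y : V) : Prop :=
  L.idxOf x < L.idxOf y

/-- `x ≤ y` in the vertex order `L`. -/
def Le {V : Type*} [DecidableEq V] (L : List V) (x y : V) : Prop :=
  L.idxOf x ≤ L.idxOf y

instance {V : Type*} [DecidableEq V] (L : List V) (x y : V) : Decidable (Lt L x y) :=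
  inferInstanceAs (Decidable (_ < _))

instance {V : Type*} [DecidableEq V] (L : List V) (x y : V) : Decidable (Le L x y) :=
  inferInstanceAs (Decidable (_ ≤ _))

/-- The smaller of two vertices in the vertex order `L`. -/
def vmin {V : Type*} [DecidableEq V] (L : List V) (x y : V) : V := if Le L x y then x else y

/-- The larger of two vertices in the vertex order `L`. -/
def vmax {V : Type*} [DecidableEq V] (L : List V) (x y : V) : V := if Le L x y then y else x

/-- `a` is an `ε`-approximate median of `G`: it lies in `G`, it is no less than `ε * |G|` of the
elements of `G`, and no greater than `ε * |G|` of the elements of `G`. -/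
def IsApproxMedian {V : Type*} [DecidableEq V] (ε : ℝ) (L : List V) (G : Finset V) (a : V) :
    Prop :=
  a ∈ G ∧ ε * (G.card : ℝ) ≤ ((G.filter fun x => Le L x a).card : ℝ) ∧
    ε * (G.card : ℝ) ≤ ((G.filter fun x => Le L a x).card : ℝ)

/-- `O` lists the vertices of `X` in a topological order of the subgraph induced by `X`. -/
def IsTopOrder {V : Type*} [DecidableEq V] (E : List (V × V)) (X : Finset V) (O : List V) :
    Prop :=
  O.Nodup ∧ (∀ x, x ∈ O ↔ x ∈ X) ∧ ∀ e ∈ E, e.1 ∈ X → e.2 ∈ X → Lt O e.1 e.2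

/-- The number of arcs that leave a vertex of `X`. -/
def arcsOut {V : Type*} [DecidableEq V] (E : List (V × V)) (X : Finset V) : ℕ :=
  E.countP fun e => decide (e.1 ∈ X)

/-- The number of arcs that enter a vertex of `Y`. -/
def arcsInto {V : Type*} [DecidableEq V] (E : List (V × V)) (Y : Finset V) : ℕ :=
  E.countP fun e => decide (e.2 ∈ Y)

/-- The state of one compatible search. -/
structure Search (V : Type*) where
  /-- low hard threshold -/
  l : V
  /-- high hard threshold -/
  h : V
  /-- soft threshold -/
  s : V
  /-- near forward candidates -/
  A : Finset V
  /-- far forward candidates -/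
  B : Finset V
  /-- near backward candidates -/
  C : Finset V
  /-- far backward candidates -/
  D : Finset V
  /-- forward vertices found to be scanned -/
  X : Finset V
  /-- backward vertices found to be scanned -/
  Y : Finset V
  /-- all forward vertices -/
  F : Finset V
  /-- all backward vertices -/
  R : Finset V
  /-- indices of the arcs traversed forward -/
  TF : Finset ℕ
  /-- indices of the arcs traversed backward -/
  TR : Finset ℕ

namespace Search

variable {V : Type*} [DecidableEq V]

/-- The search triggered by the addition of `(v, w)`, with initial soft threshold `s`. -/
def start (v w s : V) : Search V where
  l := w
  h := v
  s := s
  A := {w}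
  B := ∅
  C := {v}
  D := ∅
  X := ∅
  Y := ∅
  F := {w}
  R := {v}
  TF := ∅
  TR := ∅

/-- The main loop is over. -/
def Finished (σ : Search V) : Prop := σ.A ∪ σ.B = ∅ ∨ σ.C ∪ σ.D = ∅

/-- Case 1f: the far forward vertices become near, `l` becomes the old soft threshold, and the new
soft threshold is the vertex `a` (chosen in the new set `A`) or `h`, whichever is smaller. -/
def refillF (L : List V) (σ : Search V) (a : V) : Search V :=
  { σ with A := σ.B, B := ∅, l := σ.s, s := vmin L a σ.h }

/-- Case 1b: the mirror image of Case 1f. -/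
def refillB (L : List V) (σ : Search V) (a : V) : Search V :=
  { σ with C := σ.D, D := ∅, h := σ.s, s := vmax L a σ.l }

/-- The effect of a traversal step (without a cycle being found) along the arc with index `i`,
forward, reaching `x`, and along the arc with index `j`, backward, reaching `y`. -/
def traverse (σ : Search V) (i j : ℕ) (x y : V) : Search V :=
  { σ with
    TF := insert i σ.TF
    TR := insert j σ.TR
    F := insert x σ.F
    R := insert y σ.R
    A := if x ∈ σ.F then σ.A else insert x σ.A
    C := if y ∈ σ.R then σ.C else insert y σ.C }

open Classical in
/-- The final threshold. -/
noncomputable def finalThreshold (σ : Search V) : V := if σ.A ∪ σ.B = ∅ then σ.h else σ.l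

/-- The scanned forward vertices less than the final threshold. -/
noncomputable def finalX (L : List V) (σ : Search V) : Finset V :=
  σ.X.filter fun x => Lt L x σ.finalThreshold

/-- The scanned backward vertices greater than the final threshold. -/
noncomputable def finalY (L : List V) (σ : Search V) : Finset V :=
  σ.Y.filter fun y => Lt L σ.finalThreshold y

/-- The time charged for the end of a search that found no cycle: constant time, constant time per
element for filtering `X` and `Y`, linear time in the numbers of vertices and of arcs looked at for
topologically ordering the two final sets (every arc out of the final `X`, every arc into the final
`Y`), and constant time per vertex deleted from the vertex order and reinserted. -/
noncomputable def finishCost (L : List V) (E : List (V × V)) (σ : Search V) : ℕ :=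
  1 + (σ.X.card + σ.Y.card)
    + ((σ.finalX L).card + arcsOut E (σ.finalX L))
    + ((σ.finalY L).card + arcsInto E (σ.finalY L))
    + ((σ.finalX L).card + (σ.finalY L).card)

end Search

/-- What the algorithm is doing: waiting for the next arc, searching, or stopped after
reporting a cycle. -/
inductive Phase (V : Type*) where
  | idle : Phase V
  | searching : Search V → Phase V
  | stopped : Phase V

/-- A configuration of the algorithm: the vertex order, the arcs added so far (including the one
being processed), the current activity, and the time spent so far. -/
structure Config (V : Type*) where
  order : List V
  arcs : List (V × V)
  phase : Phase V
  time : ℕ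

/-- The initial configuration: no arcs, and a vertex order `L₀`. -/
def Config.init {V : Type*} (L₀ : List V) : Config V := ⟨L₀, [], Phase.idle, 0⟩

/-- All steps except the choice of a new soft threshold.  Every choice that the method leaves open
(the arc to be added, the initial soft threshold, the candidates `u` and `z`, which of two
applicable cases of the same number is carried out, which untraversed arcs are traversed, and the
topological orders of the final sets) is nondeterministic.  The cases are tried in the order of
their numbers, so Case 3 is considered for a pair `u`, `z` only if neither Case 2f nor Case 2b
applies to it, and Cases 4 and 5 only if moreover neither Case 3f nor Case 3b does, which then means
`u < z`. -/
inductive Step {V : Type*} [DecidableEq V] : Config V → Config V → Prop where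
  /-- The new arc agrees with the vertex order. -/
  | addForward (L : List V) (E : List (V × V)) (t : ℕ) (v w : V) (hvw : Lt L v w) :
      Step ⟨L, E, .idle, t⟩ ⟨L, E ++ [(v, w)], .idle, t + 1⟩
  /-- The new arc is a loop, hence a cycle. -/
  | addLoop (L : List V) (E : List (V × V)) (t : ℕ) (v : V) :
      Step ⟨L, E, .idle, t⟩ ⟨L, E ++ [(v, v)], .stopped, t + 1⟩
  /-- The new arc disagrees with the vertex order: a search begins. -/
  | addBackward (L : List V) (E : List (V × V)) (t : ℕ) (v w s : V) (hwv : Lt L w v)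
      (hws : Le L w s) (hsv : Le L s v) :
      Step ⟨L, E, .idle, t⟩ ⟨L, E ++ [(v, w)], .searching (.start v w s), t + 1⟩
  | case2f (L : List V) (E : List (V × V)) (t : ℕ) (σ : Search V) (u z : V)
      (hu : u ∈ σ.A) (hz : z ∈ σ.C) (h2 : Le L σ.h u) :
      Step ⟨L, E, .searching σ, t⟩ ⟨L, E, .searching { σ with A := σ.A.erase u }, t + 1⟩
  | case2b (L : List V) (E : List (V × V)) (t : ℕ) (σ : Search V) (u z : V)
      (hu : u ∈ σ.A) (hz : z ∈ σ.C) (h2 : Le L z σ.l) :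
      Step ⟨L, E, .searching σ, t⟩ ⟨L, E, .searching { σ with C := σ.C.erase z }, t + 1⟩
  | case3f (L : List V) (E : List (V × V)) (t : ℕ) (σ : Search V) (u z : V)
      (hu : u ∈ σ.A) (hz : z ∈ σ.C) (huh : Lt L u σ.h) (hlz : Lt L σ.l z)
      (h3 : Le L (vmax L z σ.s) u) :
      Step ⟨L, E, .searching σ, t⟩
        ⟨L, E, .searching { σ with A := σ.A.erase u, B := insert u σ.B }, t + 1⟩
  | case3b (L : List V) (E : List (V × V)) (t : ℕ) (σ : Search V) (u z : V)
      (hu : u ∈ σ.A) (hz : z ∈ σ.C) (huh : Lt L u σ.h) (hlz : Lt L σ.l z)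
      (h3 : Le L z (vmin L u σ.s)) :
      Step ⟨L, E, .searching σ, t⟩
        ⟨L, E, .searching { σ with C := σ.C.erase z, D := insert z σ.D }, t + 1⟩
  | case4f (L : List V) (E : List (V × V)) (t : ℕ) (σ : Search V) (u z : V)
      (hu : u ∈ σ.A) (hz : z ∈ σ.C) (huh : Lt L u σ.h) (hlz : Lt L σ.l z) (huz : Lt L u z)
      (h4 : ∀ (i : ℕ) (x : V), E[i]? = some (u, x) → i ∈ σ.TF) :
      Step ⟨L, E, .searching σ, t⟩
        ⟨L, E, .searching { σ with A := σ.A.erase u, X := insert u σ.X }, t + 1⟩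
  | case4b (L : List V) (E : List (V × V)) (t : ℕ) (σ : Search V) (u z : V)
      (hu : u ∈ σ.A) (hz : z ∈ σ.C) (huh : Lt L u σ.h) (hlz : Lt L σ.l z) (huz : Lt L u z)
      (h4 : ∀ (j : ℕ) (y : V), E[j]? = some (y, z) → j ∈ σ.TR) :
      Step ⟨L, E, .searching σ, t⟩
        ⟨L, E, .searching { σ with C := σ.C.erase z, Y := insert z σ.Y }, t + 1⟩
  /-- Case 5, no cycle found. -/
  | case5 (L : List V) (E : List (V × V)) (t : ℕ) (σ : Search V) (u z : V)
      (hu : u ∈ σ.A) (hz : z ∈ σ.C) (huh : Lt L u σ.h) (hlz : Lt L σ.l z) (huz : Lt L u z)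
      (i j : ℕ) (x y : V) (hi : E[i]? = some (u, x)) (hiT : i ∉ σ.TF)
      (hj : E[j]? = some (y, z)) (hjT : j ∉ σ.TR)
      (hx : x ∉ σ.R) (hy : y ∉ σ.F) (hxy : x ≠ y) :
      Step ⟨L, E, .searching σ, t⟩ ⟨L, E, .searching (σ.traverse i j x y), t + 2⟩
  /-- Case 5, a cycle is found (the two traversals may also meet in a vertex not reached before) and
  reported, in time linear in the number of vertices reached. -/
  | case5cycle (L : List V) (E : List (V × V)) (t : ℕ) (σ : Search V) (u z : V)
      (hu : u ∈ σ.A) (hz : z ∈ σ.C) (huh : Lt L u σ.h) (hlz : Lt L σ.l z) (huz : Lt L u z)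
      (i j : ℕ) (x y : V) (hi : E[i]? = some (u, x)) (hiT : i ∉ σ.TF)
      (hj : E[j]? = some (y, z)) (hjT : j ∉ σ.TR)
      (hcyc : x ∈ σ.R ∨ y ∈ σ.F ∨ x = y) :
      Step ⟨L, E, .searching σ, t⟩ ⟨L, E, .stopped, t + (2 + σ.F.card + σ.R.card)⟩
  /-- The end of a search, when the final threshold is not forward: the two final sets are deleted
  from the vertex order, and reinserted just after the final threshold. -/
  | finishAfter (L : List V) (E : List (V × V)) (t : ℕ) (σ : Search V) (hfin : σ.Finished)
      (hs : σ.finalThreshold ∉ σ.F) (OX OY p q : List V)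
      (hOX : IsTopOrder E (σ.finalX L) OX) (hOY : IsTopOrder E (σ.finalY L) OY)
      (hpq : (L.filter fun a => decide (a ∉ σ.finalX L ∪ σ.finalY L))
        = p ++ σ.finalThreshold :: q) :
      Step ⟨L, E, .searching σ, t⟩
        ⟨p ++ σ.finalThreshold :: (OY ++ OX ++ q), E, .idle, t + σ.finishCost L E⟩
  /-- The end of a search, when the final threshold is not backward: the two final sets are deleted
  from the vertex order, and reinserted just before the final threshold. -/
  | finishBefore (L : List V) (E : List (V × V)) (t : ℕ) (σ : Search V) (hfin : σ.Finished)
      (hs : σ.finalThreshold ∉ σ.R) (OX OY p q : List V)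
      (hOX : IsTopOrder E (σ.finalX L) OX) (hOY : IsTopOrder E (σ.finalY L) OY)
      (hpq : (L.filter fun a => decide (a ∉ σ.finalX L ∪ σ.finalY L))
        = p ++ σ.finalThreshold :: q) :
      Step ⟨L, E, .searching σ, t⟩
        ⟨p ++ (OY ++ OX) ++ σ.finalThreshold :: q, E, .idle, t + σ.finishCost L E⟩

/-- `Refill c G next`: in the configuration `c` the algorithm applies Case 1f or 1b. It moves the
far set `G` to the near set and chooses a vertex `a` of `G` for the new soft threshold, which leads
to `next a`. The time charged is constant, plus constant time per vertex of `G` for moving it, plus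
constant time per vertex of `G` for selecting `a`. -/
inductive Refill {V : Type*} [DecidableEq V] :
    Config V → Finset V → (V → Config V) → Prop where
  | fwd (L : List V) (E : List (V × V)) (t : ℕ) (σ : Search V) (hfin : ¬ σ.Finished)
      (hA : σ.A = ∅) :
      Refill ⟨L, E, .searching σ, t⟩ σ.B
        fun a => ⟨L, E, .searching (σ.refillF L a), t + (1 + σ.B.card + σ.B.card)⟩
  | bwd (L : List V) (E : List (V × V)) (t : ℕ) (σ : Search V) (hfin : ¬ σ.Finished)
      (hC : σ.C = ∅) :
      Refill ⟨L, E, .searching σ, t⟩ σ.D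
        fun a => ⟨L, E, .searching (σ.refillB L a), t + (1 + σ.D.card + σ.D.card)⟩

/-- `Run P c c'`: some (possibly unfinished) execution leads from `c` to `c'`, where every new soft
threshold `a` chosen from a set `G` while the vertex order is `L` satisfies `P L G a`. -/
inductive Run {V : Type*} [DecidableEq V] (P : List V → Finset V → V → Prop) (c : Config V) :
    Config V → Prop where
  | refl : Run P c c
  | step (d d' : Config V) (hd : Run P c d) (h : Step d d') : Run P c d'
  | refill (d : Config V) (G : Finset V) (next : V → Config V) (a : V) (hd : Run P c d)
      (h : Refill d G next) (ha : a ∈ G) (hP : P d.order G a) : Run P c (next a)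

/-- `RandomRun c μ`: some (possibly unfinished) randomized execution from `c` has `μ` as the
distribution of the configuration it arrives at, where every new soft threshold is drawn uniformly
from the set from which it is chosen, by a fresh random choice.  All other choices, including the
arcs that are added and the moment at which the execution is cut off, may depend on the random
choices made so far. -/
inductive RandomRun {V : Type*} [DecidableEq V] : Config V → PMF (Config V) → Prop where
  | refl (c : Config V) : RandomRun c (PMF.pure c)
  | step (c d : Config V) (μ : PMF (Config V)) (h : Step c d) (hμ : RandomRun d μ) :
      RandomRun c μ
  | refill (c : Config V) (G : Finset V) (hG : G.Nonempty) (next : V → Config V)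
      (ν : V → PMF (Config V)) (h : Refill c G next)
      (hν : ∀ a ∈ G, RandomRun (next a) (ν a)) :
      RandomRun c ((PMF.uniformOfFinset G hG).bind ν)

/-- The configuration admits a next step of the algorithm. -/
def CanContinue {V : Type*} [DecidableEq V] (c : Config V) : Prop :=
  (∃ d, Step c d) ∨ ∃ (G : Finset V) (next : V → Config V), G.Nonempty ∧ Refill c G next

end IncTopo

set_option linter.unusedSectionVars false

namespace IncTopo

/-! ### The potential that pays for refills. -/

section Potential

variable {V : Type*} [DecidableEq V]

/-! Correctness. `HalfInv` describes one direction of a search; the other is the same statement for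
reversed arcs and negated positions, which is why positions are integers. Every forward vertex is
near, far, scanned, or at or above `h`. Hence a finished search has in `X` all forward vertices
below the final threshold and, symmetrically, in `Y` all backward vertices above it. Moving both
sets to the threshold, `Y` first, then respects the old arcs and puts `v` before `w`
(`reorder_isTopological`).

Traversals. At most m² ordered pairs of arcs are related, meaning that the second is reachable from
the first. A search that runs Case 5 k times matches k forward arcs (u, x) with k backward arcs (y,
z), where u < z in each match. For any two matches at least one of the crossed combinations is also
compatible, so at least k²/2 combinations are. The new arc makes each of them related, and none was
related before because the old arcs agree with the vertex order (`SearchInv.card_relatedPairs`).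
Since k ≤ q + k²/(2q), there are at most qm + m²/q traversal steps in the completed searches, which
is 2m^(3/2) for q = √m.

Other work. A potential charges the rest of a search to its traversals. Its crucial term is κ times
the larger number of live candidates on the two sides of the soft threshold: whichever side is
discarded later, the other side is already accounted for. A refill releases κ times the smaller side
of the new split, and more for every candidate that is no longer live. This is a constant fraction
of the set for an approximate median, and a constant fraction on average for a random element.
`excess` is the time minus all payments: it starts at 0 and never increases, on average in the
random case (`Step.excess_le`, `Refill.exists_potential`). -/

/-- The potential of one direction of a search, with near candidates `A`, far candidates `B`,
hard thresholds `l`, `h` and soft threshold `s`, where `f` gives the positions of the vertices.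
For backward candidates `f` and the thresholds are negated. -/
noncomputable def potential (κ : ℝ) (f : V → ℤ) (A B : Finset V) (l s h : ℤ) : ℝ :=
  κ * max (((A ∪ B).filter fun u => l < f u ∧ f u < s).card : ℝ)
      (((A ∪ B).filter fun u => s < f u ∧ f u < h).card : ℝ)
    + (A.card : ℝ) + (κ + 1) * ((A.filter fun u => l < f u ∧ f u < h).card : ℝ)
    + (κ + 1) * (B.card : ℝ)

theorem potential_nonneg {κ : ℝ} (hκ : 0 ≤ κ) (f : V → ℤ) (A B : Finset V) (l s h : ℤ) :
    0 ≤ potential κ f A B l s h := by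
  unfold potential; positivity

/-- All live candidates are counted in open intervals, so a start vertex sitting at its hard
threshold contributes only its unit in `A.card`. -/
theorem potential_singleton (κ : ℝ) (f : V → ℤ) {w : V} {s : ℤ} (hs : f w ≤ s) (h : ℤ) :
    potential κ f {w} ∅ (f w) s h = 1 := by
  simp [potential, Finset.filter_singleton, hs.not_gt]

theorem potential_erase {κ : ℝ} (hκ : 0 ≤ κ) (f : V → ℤ) {A : Finset V} (B : Finset V)
    (l s h : ℤ) {u : V} (hu : u ∈ A) :
    potential κ f (A.erase u) B l s h + 1 ≤ potential κ f A B l s h := by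
  unfold potential
  have hA : ((A.erase u).card : ℝ) + 1 = A.card := by
    exact_mod_cast Finset.card_erase_add_one hu
  have hs : A.erase u ∪ B ⊆ A ∪ B := Finset.union_subset_union_left (Finset.erase_subset _ _)
  have h1 : (((A.erase u).filter fun u => l < f u ∧ f u < h).card : ℝ)
      ≤ (A.filter fun u => l < f u ∧ f u < h).card := by
    gcongr; exact Finset.erase_subset _ _
  have h2 : κ * max (((A.erase u ∪ B).filter fun u => l < f u ∧ f u < s).card : ℝ)
      (((A.erase u ∪ B).filter fun u => s < f u ∧ f u < h).card : ℝ)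
      ≤ κ * max (((A ∪ B).filter fun u => l < f u ∧ f u < s).card : ℝ)
      (((A ∪ B).filter fun u => s < f u ∧ f u < h).card : ℝ) := by
    gcongr
  have h3 := mul_le_mul_of_nonneg_left h1 (by linarith : (0 : ℝ) ≤ κ + 1)
  linarith

/-- A vertex strictly between the hard thresholds takes its weight `κ + 1` along from `A` to `B`;
the unit released is its share of `A.card`. -/
theorem potential_move {κ : ℝ} (hκ : 0 ≤ κ) (f : V → ℤ) {A : Finset V} (B : Finset V)
    {l h : ℤ} (s : ℤ) {u : V} (hu : u ∈ A) (hl : l < f u) (hh : f u < h) :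
    potential κ f (A.erase u) (insert u B) l s h + 1 ≤ potential κ f A B l s h := by
  unfold potential
  have hA : ((A.erase u).card : ℝ) + 1 = A.card := by
    exact_mod_cast Finset.card_erase_add_one hu
  have hs : A.erase u ∪ insert u B = A ∪ B := by
    ext x; by_cases hx : x = u <;> simp [hx, hu]
  have h1 : (((A.erase u).filter fun u => l < f u ∧ f u < h).card : ℝ) + 1
      = (A.filter fun u => l < f u ∧ f u < h).card := by
    rw [Finset.filter_erase]
    have hu' : u ∈ A.filter fun u => l < f u ∧ f u < h := by simp [hu, hl, hh]
    exact_mod_cast Finset.card_erase_add_one hu'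
  have h2 : ((insert u B).card : ℝ) ≤ B.card + 1 := by
    exact_mod_cast Finset.card_insert_le u B
  rw [hs, ← h1, ← hA]
  have h3 := mul_le_mul_of_nonneg_left h2 (by linarith : (0 : ℝ) ≤ κ + 1)
  linarith

/-- A new candidate adds at most `κ` to the maximum term, 1 as a near vertex and `κ + 1` as a live
one. -/
theorem potential_insert {κ : ℝ} (hκ : 0 ≤ κ) (f : V → ℤ) (A B : Finset V)
    (l s h : ℤ) (x : V) :
    potential κ f (insert x A) B l s h ≤ potential κ f A B l s h + (2 * κ + 2) := by
  unfold potential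
  have key : ∀ (S : Finset V) (p : V → Prop) [DecidablePred p],
      (((insert x S).filter p).card : ℝ) ≤ (S.filter p).card + 1 := by
    intro S p _
    have : (insert x S).filter p ⊆ insert x (S.filter p) := by
      intro y hy
      simp only [Finset.mem_filter, Finset.mem_insert] at hy ⊢
      tauto
    exact_mod_cast (Finset.card_le_card this).trans (Finset.card_insert_le _ _)
  rw [Finset.insert_union]
  have h0 : ((insert x A).card : ℝ) ≤ A.card + 1 := by
    exact_mod_cast Finset.card_insert_le x A
  have h1 := key (A ∪ B) fun u => l < f u ∧ f u < s
  have h2 := key (A ∪ B) fun u => s < f u ∧ f u < h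
  have h3 := mul_le_mul_of_nonneg_left (key A fun u => l < f u ∧ f u < h)
    (by linarith : (0 : ℝ) ≤ κ + 1)
  have h4 := mul_le_mul_of_nonneg_left
    ((max_le_max h1 h2).trans_eq (max_add_add_right _ _ (1 : ℝ))) hκ
  linarith

/-- Lowering the upper hard threshold to the soft one does not increase the potential. -/
theorem potential_narrow {κ : ℝ} (hκ : 0 ≤ κ) (f : V → ℤ) (A B : Finset V)
    {l s h s' : ℤ} (hsh : s ≤ h) (hl : l ≤ s') (hs : s' ≤ s) :
    potential κ f A B l s' s ≤ potential κ f A B l s h := by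
  unfold potential
  have h1 : ((A ∪ B).filter fun u => l < f u ∧ f u < s') ⊆
      (A ∪ B).filter fun u => l < f u ∧ f u < s :=
    Finset.monotone_filter_right _ fun u _ hu => ⟨hu.1, hu.2.trans_le hs⟩
  have h2 : ((A ∪ B).filter fun u => s' < f u ∧ f u < s) ⊆
      (A ∪ B).filter fun u => l < f u ∧ f u < s :=
    Finset.monotone_filter_right _ fun u _ hu => ⟨hl.trans_lt hu.1, hu.2⟩
  have h3 : (A.filter fun u => l < f u ∧ f u < s) ⊆ A.filter fun u => l < f u ∧ f u < h :=
    Finset.monotone_filter_right _ fun u _ hu => ⟨hu.1, hu.2.trans_le hsh⟩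
  -- Both parts of the new interval lie inside the old lower part, so its count bounds them both.
  have h4 : max (((A ∪ B).filter fun u => l < f u ∧ f u < s').card : ℝ)
      (((A ∪ B).filter fun u => s' < f u ∧ f u < s).card : ℝ)
      ≤ max (((A ∪ B).filter fun u => l < f u ∧ f u < s).card : ℝ)
      (((A ∪ B).filter fun u => s < f u ∧ f u < h).card : ℝ) :=
    (max_le (by exact_mod_cast Finset.card_le_card h1)
      (by exact_mod_cast Finset.card_le_card h2)).trans (le_max_left _ _)
  gcongr

/-- The smaller of the numbers of elements of `S` on the two sides of `a`, counting `a` on both. -/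
def balance (f : V → ℤ) (S : Finset V) (a : V) : ℕ :=
  min (S.filter fun u => f a ≤ f u).card (S.filter fun u => f u ≤ f a).card

/-- Candidates no longer strictly between the hard thresholds lose their weight `κ + 1`. For the
live ones the maximum term drops from their full number to the larger side of the split. The whole
set newly pays one unit per vertex for being near. -/
theorem potential_refill {κ : ℝ} (hκ : 0 ≤ κ) (f : V → ℤ) (B : Finset V) (l : ℤ) {s h : ℤ} {a : V}
    (hsa : s ≤ f a) :
    potential κ f B ∅ s (min (f a) h) h
        + κ * balance f (B.filter fun u => s < f u ∧ f u < h) a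
        + (κ + 1) * ((B.filter fun u => ¬(s < f u ∧ f u < h)).card : ℝ)
      ≤ potential κ f ∅ B l s h + B.card := by
  unfold potential balance
  set S := B.filter fun u => s < f u ∧ f u < h with hS
  have e1 : ((B ∪ ∅).filter fun u => s < f u ∧ f u < min (f a) h)
      = S.filter fun u => ¬ f a ≤ f u := by
    ext u; simp only [hS, Finset.union_empty, Finset.mem_filter, lt_min_iff]; grind
  have e2 : ((B ∪ ∅).filter fun u => min (f a) h < f u ∧ f u < h)
      = S.filter fun u => ¬ f u ≤ f a := by
    ext u; simp only [hS, Finset.union_empty, Finset.mem_filter, min_lt_iff]; grind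
  have c1 := Finset.card_filter_add_card_filter_not (s := S) (fun u => f a ≤ f u)
  have c2 := Finset.card_filter_add_card_filter_not (s := S) (fun u => f u ≤ f a)
  have c3 := Finset.card_filter_add_card_filter_not (s := B) (fun u => s < f u ∧ f u < h)
  rw [e1, e2, Finset.empty_union, ← hS]
  rw [← hS] at c3
  set P := (S.filter fun u => f a ≤ f u).card
  set P' := (S.filter fun u => ¬ f a ≤ f u).card
  set R := (S.filter fun u => f u ≤ f a).card
  set R' := (S.filter fun u => ¬ f u ≤ f a).card
  set d := (B.filter fun u => ¬(s < f u ∧ f u < h)).card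
  -- Each strict side of `a` is the complement of the opposite closed side, so this also holds for
  -- `a` outside `S`.
  have hmm : max P' R' + min P R = S.card := by omega
  have hmm' : max (P' : ℝ) R' + (min P R : ℕ) = S.card := by exact_mod_cast hmm
  have c3' : (S.card : ℝ) + d = B.card := by exact_mod_cast c3
  have h1 := mul_le_mul_of_nonneg_left
    (le_max_right ((B.filter fun u => l < f u ∧ f u < s).card : ℝ) S.card) hκ
  simp only [Finset.card_empty, Finset.filter_empty, Nat.cast_zero]
  rw [← c3']
  have h2 : κ * max (P' : ℝ) R' + κ * (min P R : ℕ) = κ * S.card := by rw [← mul_add, hmm']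
  nlinarith

/-- The time of a refill is paid by the potential if the new soft threshold is an approximate
median. -/
theorem potential_refill_median {ε : ℝ} (hε : 0 < ε) (f : V → ℤ) (B : Finset V) (l : ℤ)
    {s h : ℤ} {a : V} (ha : a ∈ B) (hsa : s ≤ f a)
    (h1 : ε * B.card ≤ ((B.filter fun u => f u ≤ f a).card : ℝ))
    (h2 : ε * B.card ≤ ((B.filter fun u => f a ≤ f u).card : ℝ)) :
    potential (4 / ε) f B ∅ s (min (f a) h) h + (1 + B.card + B.card)
      ≤ potential (4 / ε) f ∅ B l s h := by
  have key := potential_refill (h := h) (κ := 4 / ε) (by positivity) f B l hsa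
  set S := B.filter fun u => s < f u ∧ f u < h
  set T := B.filter fun u => ¬(s < f u ∧ f u < h)
  have aux : ∀ (p : V → Prop) [DecidablePred p],
      ((B.filter p).card : ℝ) ≤ (S.filter p).card + T.card := by
    intro p _
    have : B.filter p ⊆ S.filter p ∪ T := by
      intro x hx
      simp only [S, T, Finset.mem_filter, Finset.mem_union] at hx ⊢
      tauto
    exact_mod_cast (Finset.card_le_card this).trans (Finset.card_union_le _ _)
  -- The median property concerns all of `B`; restricting it to the live part loses at most the dead
  -- vertices, which pay for themselves.
  have hb : ε * B.card ≤ (balance f S a : ℝ) + T.card := by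
    unfold balance
    rw [Nat.cast_min, ← min_add_add_right]
    exact le_min (h2.trans (aux _)) (h1.trans (aux _))
  have hg : (1 : ℝ) ≤ B.card := by exact_mod_cast Finset.card_pos.2 ⟨a, ha⟩
  have h3 := mul_le_mul_of_nonneg_left hb (by positivity : 0 ≤ 4 / ε)
  -- The factor 4 covers the time `1 + 2 * B.card` and the units of the new near set, since `B` is
  -- nonempty.
  have h4 : 4 / ε * (ε * B.card) = 4 * B.card := by field_simp
  have h5 : (0 : ℝ) ≤ T.card := by positivity
  linarith

theorem sum_card_filter_le {f : V → ℤ} (hf : Function.Injective f) (S : Finset V) :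
    2 * ∑ a ∈ S, (S.filter fun u => f u ≤ f a).card = S.card * (S.card + 1) := by
  induction S using Finset.induction_on_max_value f with
  | empty => simp
  | insert M S hM hmax ih =>
    have h1 : ∀ a ∈ S, ((insert M S).filter fun u => f u ≤ f a) = S.filter fun u => f u ≤ f a := by
      intro a ha
      rw [Finset.filter_insert, if_neg]
      intro h
      exact hM (hf (le_antisymm h (hmax a ha)) ▸ ha)
    have h2 : ((insert M S).filter fun u => f u ≤ f M) = insert M S :=
      Finset.filter_true_of_mem fun u hu => by
        rcases Finset.mem_insert.1 hu with rfl | hu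
        · exact le_rfl
        · exact hmax u hu
    rw [Finset.sum_insert hM, h2, Finset.sum_congr rfl fun a ha => by rw [h1 a ha],
      Finset.card_insert_of_notMem hM, mul_add, ih]
    ring

/-- The element of rank k contributes k(g + 1 - k), where g is the number of elements. Adding a new
maximum raises every upper count by one, which brings in the sum of the ranks. -/
theorem sum_card_filter_mul {f : V → ℤ} (hf : Function.Injective f) (S : Finset V) :
    6 * ∑ a ∈ S, (S.filter fun u => f u ≤ f a).card * (S.filter fun u => f a ≤ f u).card
      = S.card * (S.card + 1) * (S.card + 2) := by
  induction S using Finset.induction_on_max_value f with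
  | empty => simp
  | insert M S hM hmax ih =>
    have hlt : ∀ a ∈ S, f a < f M := fun a ha => lt_of_le_of_ne (hmax a ha) fun h =>
      hM (hf h ▸ ha)
    have h1 : ∀ a ∈ S, ((insert M S).filter fun u => f u ≤ f a) = S.filter fun u => f u ≤ f a := by
      intro a ha
      rw [Finset.filter_insert, if_neg (hlt a ha).not_ge]
    have h1' : ∀ a ∈ S, ((insert M S).filter fun u => f a ≤ f u).card
        = (S.filter fun u => f a ≤ f u).card + 1 := by
      intro a ha
      rw [Finset.filter_insert, if_pos (hlt a ha).le, Finset.card_insert_of_notMem]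
      simp [hM]
    have h2 : ((insert M S).filter fun u => f u ≤ f M) = insert M S :=
      Finset.filter_true_of_mem fun u hu => by
        rcases Finset.mem_insert.1 hu with rfl | hu
        · exact le_rfl
        · exact hmax u hu
    have h2' : ((insert M S).filter fun u => f M ≤ f u) = {M} := by
      ext u
      simp only [Finset.mem_filter, Finset.mem_insert, Finset.mem_singleton]
      constructor
      · rintro ⟨rfl | hu, h⟩
        · rfl
        · exact absurd h (hlt u hu).not_ge
      · rintro rfl; simp
    have h3 := sum_card_filter_le hf S
    rw [Finset.sum_insert hM, h2, h2', Finset.sum_congr rfl fun a ha => by rw [h1 a ha, h1' a ha],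
      Finset.card_insert_of_notMem hM, Finset.card_singleton]
    simp only [mul_add, mul_one, Finset.sum_add_distrib]
    rw [ih]
    linarith

/-- The smaller of two counts is at least their product divided by a bound on the larger. The bound
`S.card + 1` cancels against a factor of the exact sum of the products. -/
theorem card_sq_le_sum_balance {f : V → ℤ} (hf : Function.Injective f) (S : Finset V) :
    (S.card : ℝ) ^ 2 ≤ 6 * ∑ a ∈ S, (balance f S a : ℝ) := by
  have h1 : ∀ a ∈ S, (S.filter fun u => f u ≤ f a).card * (S.filter fun u => f a ≤ f u).card
      ≤ (S.card + 1) * balance f S a := by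
    intro a _
    have h : (S.filter fun u => f u ≤ f a).card ≤ S.card := Finset.card_filter_le _ _
    have h' : (S.filter fun u => f a ≤ f u).card ≤ S.card := Finset.card_filter_le _ _
    unfold balance
    rcases le_total (S.filter fun u => f u ≤ f a).card (S.filter fun u => f a ≤ f u).card with k | k
    · rw [min_eq_right k, mul_comm]; gcongr; omega
    · rw [min_eq_left k]; gcongr; omega
  have h2 := Finset.sum_le_sum h1
  rw [← Finset.mul_sum] at h2
  have h3 := sum_card_filter_mul hf S
  have h4 : S.card * (S.card + 2) ≤ 6 * ∑ a ∈ S, balance f S a := by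
    have : (S.card + 1) * (S.card * (S.card + 2)) ≤ (S.card + 1) * (6 * ∑ a ∈ S, balance f S a) := by
      nlinarith
    exact Nat.le_of_mul_le_mul_left this (Nat.succ_pos _)
  have h5 : S.card ^ 2 ≤ 6 * ∑ a ∈ S, balance f S a := by nlinarith
  exact_mod_cast h5

/-- The expected time of a refill is paid by the expected decrease of the potential if the new soft
threshold is uniformly random. -/
theorem potential_refill_random {f : V → ℤ} (hf : Function.Injective f) (B : Finset V) (l : ℤ)
    {s h : ℤ} (hsB : ∀ a ∈ B, s ≤ f a) :
    ∑ a ∈ B, (potential 24 f B ∅ s (min (f a) h) h + (1 + B.card + B.card))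
      ≤ B.card * potential 24 f ∅ B l s h := by
  rcases B.eq_empty_or_nonempty with rfl | hB
  · simp
  set S := B.filter fun u => s < f u ∧ f u < h with hS
  set T := B.filter fun u => ¬(s < f u ∧ f u < h) with hT
  have h1 : ∀ a ∈ B, potential 24 f B ∅ s (min (f a) h) h + (1 + B.card + B.card)
      ≤ (potential 24 f ∅ B l s h + (1 + 3 * B.card) - 25 * T.card) - 24 * balance f S a := by
    intro a ha
    have := potential_refill (h := h) (κ := 24) (by norm_num) f B l (hsB a ha)
    rw [← hS, ← hT] at this
    linarith
  refine (Finset.sum_le_sum h1).trans ?_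
  rw [Finset.sum_sub_distrib, ← Finset.mul_sum, Finset.sum_const, nsmul_eq_mul]
  have h2 := card_sq_le_sum_balance hf S
  -- Thresholds drawn from the dead vertices may balance nothing; their terms are dropped.
  have h3 : ∑ a ∈ S, (balance f S a : ℝ) ≤ ∑ a ∈ B, (balance f S a : ℝ) :=
    Finset.sum_le_sum_of_subset_of_nonneg (Finset.filter_subset _ _) fun _ _ _ => by positivity
  have c3 : S.card + T.card = B.card :=
    Finset.card_filter_add_card_filter_not (s := B) (fun u => s < f u ∧ f u < h)
  have c3' : (S.card : ℝ) + T.card = B.card := by exact_mod_cast c3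
  have hg : (1 : ℝ) ≤ B.card := by exact_mod_cast Finset.card_pos.2 hB
  have hT0 : (0 : ℝ) ≤ T.card := by positivity
  have hS0 : (0 : ℝ) ≤ S.card := by positivity
  have h4 : (B.card : ℝ) * (1 + 3 * B.card) ≤ 4 * B.card ^ 2 := by nlinarith
  -- Here 24 = 6 · 4 turns the balance sum into four times the square of the live number, and 25 = κ
  -- + 1 is the weight of a dead vertex.
  have h5 : 4 * (B.card : ℝ) ^ 2 ≤ 25 * T.card * B.card + 4 * (S.card : ℝ) ^ 2 := by
    rw [← c3']; nlinarith [mul_nonneg hT0 hS0]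
  nlinarith

end Potential

/-! ### Vertex orders, positions and the final reordering. -/

section Order

variable {V : Type*} [DecidableEq V]

/-- Precedence becomes a two-element sublist, a form that is stable under filtering and appending
lists. -/
theorem Lt.of_sublist {L : List V} (hL : L.Nodup) {a b : V} (h : [a, b].Sublist L) : Lt L a b := by
  unfold Lt
  induction L with
  | nil => cases h
  | cons x L ih =>
    rw [List.nodup_cons] at hL
    cases h with
    | cons _ h =>
      have ha : x ≠ a := fun e => hL.1 (e ▸ h.subset (by simp))
      have hb : x ≠ b := fun e => hL.1 (e ▸ h.subset (by simp))
      rw [List.idxOf_cons_ne _ ha, List.idxOf_cons_ne _ hb]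
      have := ih hL.2 h
      omega
    | cons_cons _ h =>
      have hb : a ≠ b := fun e => hL.1 (e ▸ h.subset (by simp))
      rw [List.idxOf_cons_self, List.idxOf_cons_ne _ hb]
      omega

theorem Lt.sublist {L : List V} {a b : V} (hb : b ∈ L) (h : Lt L a b) : [a, b].Sublist L := by
  unfold Lt at h
  induction L with
  | nil => simp at hb
  | cons x L ih =>
    by_cases ha : x = a
    · subst ha
      have hxb : b ≠ x := by rintro rfl; omega
      exact .cons_cons _ (List.singleton_sublist.2 ((List.mem_cons.1 hb).resolve_left hxb))
    · have hxb : x ≠ b := by rintro rfl; simp at h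
      rw [List.idxOf_cons_ne _ ha, List.idxOf_cons_ne _ hxb] at h
      exact .cons _ (ih ((List.mem_cons.1 hb).resolve_left (Ne.symm hxb)) (by omega))

theorem Lt.of_append {L M : List V} (h : (L ++ M).Nodup) {a b : V} (ha : a ∈ L) (hb : b ∈ M) :
    Lt (L ++ M) a b :=
  .of_sublist h <| (List.singleton_sublist.2 ha).append (List.singleton_sublist.2 hb)

/-- The position of a vertex. -/
def pos (L : List V) (x : V) : ℤ := L.idxOf x

theorem lt_iff_pos {L : List V} {x y : V} : Lt L x y ↔ pos L x < pos L y := by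
  simp [Lt, pos]

theorem le_iff_pos {L : List V} {x y : V} : Le L x y ↔ pos L x ≤ pos L y := by
  simp [Le, pos]

theorem pos_vmin (L : List V) (x y : V) : pos L (vmin L x y) = min (pos L x) (pos L y) := by
  unfold vmin; split_ifs with h <;> rw [le_iff_pos] at h
  · rw [min_eq_left h]
  · rw [min_eq_right (not_le.1 h).le]

theorem pos_vmax (L : List V) (x y : V) : pos L (vmax L x y) = max (pos L x) (pos L y) := by
  unfold vmax; split_ifs with h <;> rw [le_iff_pos] at h
  · rw [max_eq_right h]
  · rw [max_eq_left (not_le.1 h).le]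

theorem pos_injective {L : List V} (hL : ∀ x, x ∈ L) : Function.Injective (pos L) := by
  intro x y h
  simp only [pos, Nat.cast_inj] at h
  exact (List.idxOf_inj (hL x)).1 h

/-- A topological order of an induced subgraph exists if its arcs agree with the order `L`. -/
theorem exists_isTopOrder {L : List V} (hL : L.Nodup) (hc : ∀ x, x ∈ L) {E : List (V × V)}
    {X : Finset V} (h : ∀ e ∈ E, e.1 ∈ X → e.2 ∈ X → Lt L e.1 e.2) : ∃ O, IsTopOrder E X O := by
  refine ⟨L.filter (· ∈ X), hL.filter _, by simp [hc], fun e he h1 h2 => ?_⟩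
  refine .of_sublist (hL.filter _) ?_
  have := ((h e he h1 h2).sublist (hc _)).filter (fun x => decide (x ∈ X))
  simpa [h1, h2] using this

/-- Moving `Y` and `X` between the lower part `P` and the upper part `Q` of the other vertices
makes all arcs agree with the order. -/
theorem reorder_isTopological {L : List V} (hL : L.Nodup) (hc : ∀ x, x ∈ L) {E : List (V × V)}
    {v w : V} {F R X Y : Finset V} {low : V → Prop} {P Q OX OY : List V}
    (hE : ∀ e ∈ E, Lt L e.1 e.2 ∨ e = (v, w))
    (hv : v ∈ R) (hw : w ∈ F) (hFR : ∀ x ∈ F, x ∉ R)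
    (hlow : ∀ a b, Lt L a b → low b → low a)
    (hXF : ∀ x ∈ X, x ∈ F)
    (hXl : ∀ x ∈ X, low x) (hYl : ∀ y ∈ Y, ¬ low y)
    (hF : ∀ x ∈ F, low x → x ∈ X) (hR : ∀ y ∈ R, ¬ low y → y ∈ Y)
    (hX : ∀ e ∈ E, e.1 ∈ X → e.2 ∈ F) (hY : ∀ e ∈ E, e.2 ∈ Y → e.1 ∈ R)
    (hOX : IsTopOrder E X OX) (hOY : IsTopOrder E Y OY)
    (hPQ : (L.filter fun a => decide (a ∉ X ∪ Y)) = P ++ Q)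
    (hP : ∀ x ∈ P, low x) (hQ : ∀ x ∈ Q, ¬ low x) :
    (P ++ (OY ++ (OX ++ Q))).Nodup ∧ (∀ x, x ∈ P ++ (OY ++ (OX ++ Q))) ∧
      ∀ e ∈ E, Lt (P ++ (OY ++ (OX ++ Q))) e.1 e.2 := by
  obtain ⟨nX, mX, tX⟩ := hOX
  obtain ⟨nY, mY, tY⟩ := hOY
  have nPQ : (P ++ Q).Nodup := hPQ ▸ hL.filter _
  have mPQ : ∀ x, x ∈ P ∨ x ∈ Q ↔ x ∉ X ∧ x ∉ Y := by
    intro x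
    rw [← List.mem_append, ← hPQ]
    simp [hc]
  have mP : ∀ x, x ∉ X → x ∉ Y → low x → x ∈ P := by grind
  have mQ : ∀ x, x ∉ X → x ∉ Y → ¬ low x → x ∈ Q := by grind
  have nN : (P ++ (OY ++ (OX ++ Q))).Nodup := by
    rw [List.nodup_append] at nPQ
    simp only [List.nodup_append, List.mem_append]
    grind
  refine ⟨nN, by grind, ?_⟩
  rintro ⟨a, b⟩ he
  have hab := hE _ he
  have hXe := hX _ he
  have hYe := hY _ he
  simp only [Prod.mk.injEq] at hab hXe hYe ⊢
  have rY : ∀ {a b}, a ∈ OY → b ∈ OX ++ Q → Lt (P ++ (OY ++ (OX ++ Q))) a b := fun ha hb =>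
    .of_sublist nN (((List.singleton_sublist.2 ha).append
      (List.singleton_sublist.2 hb)).trans (List.sublist_append_right _ _))
  have rX : ∀ {a b}, a ∈ OX → b ∈ Q → Lt (P ++ (OY ++ (OX ++ Q))) a b := fun ha hb =>
    .of_sublist nN (((List.singleton_sublist.2 ha).append
      (List.singleton_sublist.2 hb)).trans ((List.sublist_append_right _ _).trans
        (List.sublist_append_right _ _)))
  have rP : ∀ {a b}, a ∈ P → b ∈ OY ++ (OX ++ Q) → Lt (P ++ (OY ++ (OX ++ Q))) a b :=
    fun ha hb => .of_append nN ha hb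
  -- The head is forward, so it is in `X` or stays in the upper part; it is not in `Y`, whose
  -- incoming arcs have backward tails.
  by_cases haX : a ∈ X
  · by_cases hbX : b ∈ X
    · exact .of_sublist nN (((tX _ he haX hbX).sublist ((mX b).2 hbX)).trans
        ((List.sublist_append_left _ _).trans ((List.sublist_append_right _ _).trans
        (List.sublist_append_right _ _))))
    · exact rX ((mX a).2 haX) (by grind)
  -- Dually, the tail is backward: it is in `Y` or stays in the lower part.
  by_cases hbY : b ∈ Y
  · by_cases haY : a ∈ Y
    · exact .of_sublist nN (((tY _ he haY hbY).sublist ((mY b).2 hbY)).trans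
        ((List.sublist_append_left _ _).trans (List.sublist_append_right _ _)))
    · exact rP (by grind) (by grind)
  -- The head cannot stay in the lower part: an old arc would make `a` low as well, and `w`, if low,
  -- is in `X`.
  by_cases haY : a ∈ Y
  · exact rY ((mY a).2 haY) (by grind)
  by_cases hbX : b ∈ X
  · exact rP (by grind) (by grind)
  rcases hab with hab | ⟨rfl, rfl⟩
  · have h1 := (hab.sublist (hc _)).filter (fun a => decide (a ∉ X ∪ Y))
    rw [hPQ] at h1
    have h2 : [a, b].Sublist (P ++ Q) := by simpa [haX, haY, hbX, hbY] using h1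
    exact .of_sublist nN (h2.trans ((List.Sublist.refl _).append
      ((List.sublist_append_right _ _).trans (List.sublist_append_right _ _))))
  -- The new arc: `v`, backward and outside `Y`, is low, while `w`, forward and outside `X`, is not.
  · exact rP (by grind) (by grind)

end Order

/-! ### Invariants of the search and of the algorithm. -/

section Invariant

variable {V : Type*} [DecidableEq V]

/-- There is a path from `x` to `y`. -/
def Reach (E : List (V × V)) (x y : V) : Prop := Relation.ReflTransGen (fun a b => (a, b) ∈ E) x y

theorem Reach.mono {E E' : List (V × V)} (h : ∀ e ∈ E, e ∈ E') {x y : V} (hr : Reach E x y) :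
    Reach E' x y :=
  Relation.ReflTransGen.mono (fun a b (ha : (a, b) ∈ E) => h _ ha) _ _ hr

/-- The invariant of one direction of a search: `f` gives the positions of the vertices, `E` are the
arcs, `E'` those present before the addition that triggered the search, and `w` is the vertex where
the traversals in this direction start. For the backward direction, the arcs are reversed, and `f`
and the thresholds are negated. -/
structure HalfInv (f : V → ℤ) (E E' : List (V × V)) (w : V) (A B X F : Finset V) (T : Finset ℕ)
    (l s h : ℤ) : Prop where
  start : w ∈ F
  reach : ∀ x ∈ F, Reach E' w x
  nearF : ∀ x ∈ A, x ∈ F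
  farF : ∀ x ∈ B, x ∈ F
  scannedF : ∀ x ∈ X, x ∈ F
  le_near : ∀ x ∈ A, l ≤ f x
  soft_le_far : ∀ x ∈ B, s ≤ f x
  lt_far : ∀ x ∈ B, l < f x
  cover : ∀ x ∈ F, x ∈ A ∨ x ∈ B ∨ x ∈ X ∨ h ≤ f x
  scan : ∀ x ∈ X, ∀ (i : ℕ) (y : V), E[i]? = some (x, y) → i ∈ T
  arcs : ∀ i ∈ T, ∃ u x, E'[i]? = some (u, x) ∧ E[i]? = some (u, x) ∧ u ∈ F ∧ x ∈ F
  card : F.card ≤ T.card + 1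

namespace HalfInv

variable {f : V → ℤ} {E E' : List (V × V)} {w : V} {A B X F : Finset V} {T : Finset ℕ}
    {l s h : ℤ}

theorem init (f : V → ℤ) (E E' : List (V × V)) (w : V) (s h : ℤ) :
    HalfInv f E E' w {w} ∅ ∅ {w} ∅ (f w) s h where
  start := by simp
  reach := by
    intro x hx
    rw [Finset.mem_singleton] at hx
    subst hx
    exact Relation.ReflTransGen.refl
  nearF := by simp
  farF := by simp
  scannedF := by simp
  le_near := by simp
  soft_le_far := by simp
  lt_far := by simp
  cover := by simp
  scan := by simp
  arcs := by simp
  card := by simp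

theorem erase (H : HalfInv f E E' w A B X F T l s h) {u : V} (hu : h ≤ f u) :
    HalfInv f E E' w (A.erase u) B X F T l s h :=
  { H with
    nearF := fun x hx => H.nearF x (Finset.mem_of_mem_erase hx)
    le_near := fun x hx => H.le_near x (Finset.mem_of_mem_erase hx)
    cover := by
      intro x hx
      by_cases hxu : x = u
      · subst hxu; exact .inr (.inr (.inr hu))
      · simpa [hxu] using H.cover x hx }

theorem move (H : HalfInv f E E' w A B X F T l s h) {u : V} (hu : u ∈ A) (hs : s ≤ f u)
    (hl : l < f u) : HalfInv f E E' w (A.erase u) (insert u B) X F T l s h :=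
  { H with
    nearF := fun x hx => H.nearF x (Finset.mem_of_mem_erase hx)
    le_near := fun x hx => H.le_near x (Finset.mem_of_mem_erase hx)
    farF := by
      have := H.farF; have := H.nearF u hu; simp only [Finset.mem_insert]; grind
    soft_le_far := by
      have := H.soft_le_far; simp only [Finset.mem_insert]; grind
    lt_far := by
      have := H.lt_far; simp only [Finset.mem_insert]; grind
    cover := by
      intro x hx
      by_cases hxu : x = u
      · simp [hxu]
      · simpa [hxu] using H.cover x hx }

theorem scanned (H : HalfInv f E E' w A B X F T l s h) {u : V} (hu : u ∈ A)
    (h4 : ∀ (i : ℕ) (x : V), E[i]? = some (u, x) → i ∈ T) :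
    HalfInv f E E' w (A.erase u) B (insert u X) F T l s h :=
  { H with
    nearF := fun x hx => H.nearF x (Finset.mem_of_mem_erase hx)
    le_near := fun x hx => H.le_near x (Finset.mem_of_mem_erase hx)
    scannedF := by
      have := H.scannedF; have := H.nearF u hu; simp only [Finset.mem_insert]; grind
    scan := by
      have := H.scan; simp only [Finset.mem_insert]; grind
    cover := by
      intro x hx
      by_cases hxu : x = u
      · simp [hxu]
      · simpa [hxu] using H.cover x hx }

theorem traverse (H : HalfInv f E E' w A B X F T l s h) {u x : V} (hu : u ∈ A) {i : ℕ}
    (hi : E[i]? = some (u, x)) (hi' : E'[i]? = some (u, x)) (hux : f u < f x) (hiT : i ∉ T) :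
    HalfInv f E E' w (if x ∈ F then A else insert x A) B X (insert x F) (insert i T) l s h where
  start := Finset.mem_insert_of_mem H.start
  reach := by
    intro y hy
    rcases Finset.mem_insert.1 hy with rfl | hy
    · exact (H.reach u (H.nearF u hu)).tail (List.mem_of_getElem? hi')
    · exact H.reach y hy
  nearF := by
    have := H.nearF; split_ifs <;> simp only [Finset.mem_insert] <;> grind
  farF := fun y hy => Finset.mem_insert_of_mem (H.farF y hy)
  scannedF := fun y hy => Finset.mem_insert_of_mem (H.scannedF y hy)
  le_near := by
    have h1 := H.le_near
    have h2 := h1 u hu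
    split_ifs
    · exact h1
    · simp only [Finset.mem_insert]
      rintro y (rfl | hy)
      · exact h2.trans hux.le
      · exact h1 y hy
  soft_le_far := H.soft_le_far
  lt_far := H.lt_far
  cover := by
    have := H.cover
    split_ifs <;> simp only [Finset.mem_insert] <;> grind
  scan := fun y hy j z hj => Finset.mem_insert_of_mem (H.scan y hy j z hj)
  arcs := by
    intro j hj
    rcases Finset.mem_insert.1 hj with rfl | hj
    · exact ⟨u, x, hi', hi, Finset.mem_insert_of_mem (H.nearF u hu), Finset.mem_insert_self _ _⟩
    · obtain ⟨a, b, h1, h2, h3, h4⟩ := H.arcs j hj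
      exact ⟨a, b, h1, h2, Finset.mem_insert_of_mem h3, Finset.mem_insert_of_mem h4⟩
  card := by
    rw [Finset.card_insert_of_notMem hiT]
    have := H.card; have := Finset.card_insert_le x F
    omega

/-- Far vertices are at or above the soft threshold, which becomes the lower hard threshold. -/
theorem refill (H : HalfInv f E E' w A B X F T l s h) (hA : A = ∅) (s' : ℤ) :
    HalfInv f E E' w B ∅ X F T s s' h :=
  { H with
    nearF := H.farF
    le_near := H.soft_le_far
    farF := by simp
    soft_le_far := by simp
    lt_far := by simp
    cover := by
      intro x hx
      simpa [hA] using H.cover x hx }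

/-- The effect of a refill in the opposite direction: vertices beyond the old `h` are beyond the old
`s` too. -/
theorem narrow (H : HalfInv f E E' w A B X F T l s h) {s' : ℤ} (hs : s' ≤ s) (hsh : s ≤ h) :
    HalfInv f E E' w A B X F T l s' s :=
  { H with
    soft_le_far := fun x hx => hs.trans (H.soft_le_far x hx)
    cover := by
      intro x hx
      have := H.cover x hx
      grind }

end HalfInv

/-- The arcs with their directions reversed. -/
def swapArcs (E : List (V × V)) : List (V × V) := E.map Prod.swap

theorem getElem?_swapArcs {E : List (V × V)} {i : ℕ} {x y : V} :
    (swapArcs E)[i]? = some (x, y) ↔ E[i]? = some (y, x) := by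
  simp [swapArcs, List.getElem?_map, Option.map_eq_some_iff, Prod.swap_eq_iff_eq_swap]

theorem reach_swapArcs {E : List (V × V)} {x y : V} :
    Reach (swapArcs E) x y ↔ Reach E y x := by
  unfold Reach
  rw [← Relation.reflTransGen_swap]
  have : (fun a b => (a, b) ∈ swapArcs E) = Function.swap fun a b => (a, b) ∈ E := by
    funext a b
    simp [swapArcs, Function.swap]
  rw [this]

/-- The invariant of a search triggered by the addition of `(v, w)` to `E`. -/
structure SearchInv (L : List V) (E : List (V × V)) (v w : V) (σ : Search V) : Prop where
  fwd : HalfInv (pos L) (E ++ [(v, w)]) E w σ.A σ.B σ.X σ.F σ.TF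
    (pos L σ.l) (pos L σ.s) (pos L σ.h)
  bwd : HalfInv (fun x => -pos L x) (swapArcs (E ++ [(v, w)])) (swapArcs E) v σ.C σ.D σ.Y σ.R σ.TR
    (-pos L σ.h) (-pos L σ.s) (-pos L σ.l)
  le_soft : pos L σ.l ≤ pos L σ.s
  soft_le : pos L σ.s ≤ pos L σ.h
  disjoint : ∀ x ∈ σ.F, x ∉ σ.R
  compatible : ∃ T : Finset (ℕ × ℕ), T.image Prod.fst = σ.TF ∧ T.image Prod.snd = σ.TR ∧
    T.card = σ.TF.card ∧ T.card = σ.TR.card ∧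
    ∀ p ∈ T, ∀ u x y z, E[p.1]? = some (u, x) → E[p.2]? = some (y, z) → pos L u < pos L z

/-- The arcs agree with the vertex order. -/
def Topological (L : List V) (E : List (V × V)) : Prop := ∀ e ∈ E, Lt L e.1 e.2

/-- The invariant of the algorithm. -/
structure Inv (c : Config V) : Prop where
  nodup : c.order.Nodup
  complete : ∀ x, x ∈ c.order
  idle : c.phase = .idle → Topological c.order c.arcs
  searching : ∀ σ, c.phase = .searching σ → ∃ E v w, c.arcs = E ++ [(v, w)] ∧
    Topological c.order E ∧ Lt c.order w v ∧ SearchInv c.order E v w σ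

theorem Inv.init {L : List V} (hL : L.Nodup) (hc : ∀ x, x ∈ L) : Inv (Config.init L) :=
  ⟨hL, hc, fun _ => by simp [Config.init, Topological], fun σ h => by simp [Config.init] at h⟩

theorem SearchInv.start (L : List V) (E : List (V × V)) {v w s : V} (hwv : Lt L w v)
    (hws : Le L w s) (hsv : Le L s v) : SearchInv L E v w (.start v w s) where
  fwd := HalfInv.init ..
  bwd := HalfInv.init ..
  le_soft := le_iff_pos.1 hws
  soft_le := le_iff_pos.1 hsv
  disjoint := by
    simp only [Search.start, Finset.mem_singleton]
    rintro x rfl rfl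
    simp [Lt] at hwv
  compatible := ⟨∅, by simp [Search.start]⟩

theorem getElem?_of_ne {E : List (V × V)} {v w u x : V} {i : ℕ}
    (h : (E ++ [(v, w)])[i]? = some (u, x)) (hne : (u, x) ≠ (v, w)) : E[i]? = some (u, x) := by
  rw [List.getElem?_append] at h
  split_ifs at h with hi
  · exact h
  · rw [List.getElem?_singleton] at h
    split_ifs at h
    exact absurd (Option.some.inj h).symm hne

/-! ### Preservation of the invariant within a search. -/

section Steps

variable {L : List V} {E : List (V × V)} {v w : V} {σ : Search V} {u z : V}

theorem SearchInv.case2f (H : SearchInv L E v w σ) (h2 : Le L σ.h u) :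
    SearchInv L E v w { σ with A := σ.A.erase u } :=
  { H with fwd := H.fwd.erase (le_iff_pos.1 h2) }

theorem SearchInv.case2b (H : SearchInv L E v w σ) (h2 : Le L z σ.l) :
    SearchInv L E v w { σ with C := σ.C.erase z } :=
  { H with bwd := H.bwd.erase (neg_le_neg (le_iff_pos.1 h2)) }

theorem SearchInv.case3f (H : SearchInv L E v w σ) (hu : u ∈ σ.A) (hlz : Lt L σ.l z)
    (h3 : Le L (vmax L z σ.s) u) :
    SearchInv L E v w { σ with A := σ.A.erase u, B := insert u σ.B } := by
  rw [le_iff_pos, pos_vmax, max_le_iff] at h3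
  exact { H with fwd := H.fwd.move hu h3.2 ((lt_iff_pos.1 hlz).trans_le h3.1) }

theorem SearchInv.case3b (H : SearchInv L E v w σ) (hz : z ∈ σ.C) (huh : Lt L u σ.h)
    (h3 : Le L z (vmin L u σ.s)) :
    SearchInv L E v w { σ with C := σ.C.erase z, D := insert z σ.D } := by
  rw [le_iff_pos, pos_vmin, le_min_iff] at h3
  exact { H with
    bwd := H.bwd.move hz (neg_le_neg h3.2) (neg_lt_neg (h3.1.trans_lt (lt_iff_pos.1 huh))) }

theorem SearchInv.case4f (H : SearchInv L E v w σ) (hu : u ∈ σ.A)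
    (h4 : ∀ (i : ℕ) (x : V), (E ++ [(v, w)])[i]? = some (u, x) → i ∈ σ.TF) :
    SearchInv L E v w { σ with A := σ.A.erase u, X := insert u σ.X } :=
  { H with fwd := H.fwd.scanned hu h4 }

theorem SearchInv.case4b (H : SearchInv L E v w σ) (hz : z ∈ σ.C)
    (h4 : ∀ (i : ℕ) (y : V), (E ++ [(v, w)])[i]? = some (y, z) → i ∈ σ.TR) :
    SearchInv L E v w { σ with C := σ.C.erase z, Y := insert z σ.Y } :=
  { H with bwd := H.bwd.scanned hz fun i y hi => h4 i y (getElem?_swapArcs.1 hi) }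

theorem SearchInv.case5 (H : SearchInv L E v w σ) (hE : Topological L E) (hu : u ∈ σ.A)
    (hz : z ∈ σ.C) (huz : Lt L u z) {i j : ℕ} {x y : V}
    (hi : (E ++ [(v, w)])[i]? = some (u, x)) (hiT : i ∉ σ.TF)
    (hj : (E ++ [(v, w)])[j]? = some (y, z)) (hjT : j ∉ σ.TR)
    (hx : x ∉ σ.R) (hy : y ∉ σ.F) (hxy : x ≠ y) :
    SearchInv L E v w (σ.traverse i j x y) := by
  -- Traversing the new arc would make `v` forward or, in the other direction, `w` backward.
  have huv : (u, x) ≠ (v, w) := fun h => by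
    cases h
    exact H.disjoint _ (H.fwd.nearF _ hu) H.bwd.start
  have hzw : (y, z) ≠ (v, w) := fun h => by
    cases h
    exact H.disjoint _ H.fwd.start (H.bwd.nearF _ hz)
  have hi' := getElem?_of_ne hi huv
  have hj' := getElem?_of_ne hj hzw
  have hux := lt_iff_pos.1 (hE _ (List.mem_of_getElem? hi'))
  have hyz := lt_iff_pos.1 (hE _ (List.mem_of_getElem? hj'))
  obtain ⟨T, h1, h2, h3, h4, h5⟩ := H.compatible
  have hT : (i, j) ∉ T := fun h => hiT (h1 ▸ Finset.mem_image_of_mem Prod.fst h)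
  exact
    { H with
      fwd := H.fwd.traverse hu hi hi' hux hiT
      bwd := H.bwd.traverse hz (getElem?_swapArcs.2 hj) (getElem?_swapArcs.2 hj')
        (neg_lt_neg hyz) hjT
      disjoint := by
        have := H.disjoint
        simp only [Search.traverse, Finset.mem_insert]
        grind
      compatible := by
        refine ⟨insert (i, j) T, by simp [h1, Search.traverse], by simp [h2, Search.traverse],
          ?_, ?_, ?_⟩
        · simp [Search.traverse, hT, hiT, h3]
        · simp [Search.traverse, hT, hjT, h4]
        · intro p hp
          rcases Finset.mem_insert.1 hp with rfl | hp
          · intro u' x' y' z' hu' hz'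
            rw [hi'] at hu'
            rw [hj'] at hz'
            cases hu'; cases hz'
            exact lt_iff_pos.1 huz
          · exact h5 p hp }

theorem SearchInv.refillF (H : SearchInv L E v w σ) (hA : σ.A = ∅) {a : V} (ha : a ∈ σ.B) :
    SearchInv L E v w (σ.refillF L a) := by
  have h1 : pos L σ.s ≤ min (pos L a) (pos L σ.h) := le_min (H.fwd.soft_le_far a ha) H.soft_le
  have h2 := pos_vmin L a σ.h
  exact
    { H with
      fwd := H.fwd.refill hA _
      bwd := H.bwd.narrow (neg_le_neg (h1.trans h2.ge)) (neg_le_neg H.le_soft)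
      le_soft := h1.trans h2.ge
      soft_le := h2.le.trans (min_le_right _ _) }

theorem SearchInv.refillB (H : SearchInv L E v w σ) (hC : σ.C = ∅) {a : V} (ha : a ∈ σ.D) :
    SearchInv L E v w (σ.refillB L a) := by
  have h1 : max (pos L a) (pos L σ.l) ≤ pos L σ.s :=
    max_le (neg_le_neg_iff.1 (H.bwd.soft_le_far a ha)) H.le_soft
  have h2 := pos_vmax L a σ.l
  exact
    { H with
      bwd := H.bwd.refill hC _
      fwd := H.fwd.narrow (h2.le.trans h1) H.soft_le
      le_soft := (le_max_right _ _).trans h2.ge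
      soft_le := h2.le.trans h1 }

end Steps

/-! ### The end of a search. -/

section Finish

variable {L : List V} {E : List (V × V)} {v w : V} {σ : Search V}

/-- With threshold `h`, no candidate is left and `cover` leaves only `X`; with threshold `l`, all
candidates and everything beyond `h` are at or above it. -/
theorem SearchInv.mem_X (H : SearchInv L E v w σ) {x : V} (hx : x ∈ σ.F)
    (h : Lt L x σ.finalThreshold) : x ∈ σ.finalX L := by
  refine Finset.mem_filter.2 ⟨?_, h⟩
  have h1 := H.fwd.cover x hx
  have h2 := H.fwd.le_near x
  have h3 := H.fwd.lt_far x
  have h4 := H.le_soft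
  have h5 := H.soft_le
  rw [lt_iff_pos] at h
  unfold Search.finalThreshold at h
  split_ifs at h with hAB
  · have : x ∉ σ.A ∪ σ.B := by simp [hAB]
    grind
  · grind

theorem SearchInv.mem_Y (H : SearchInv L E v w σ) (hfin : σ.Finished) {y : V} (hy : y ∈ σ.R)
    (h : Lt L σ.finalThreshold y) : y ∈ σ.finalY L := by
  refine Finset.mem_filter.2 ⟨?_, h⟩
  have h1 := H.bwd.cover y hy
  have h2 := H.bwd.le_near y
  have h3 := H.bwd.lt_far y
  have h4 := H.le_soft
  have h5 := H.soft_le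
  rw [lt_iff_pos] at h
  unfold Search.finalThreshold at h
  split_ifs at h with hAB
  · grind
  · have : y ∉ σ.C ∪ σ.D := by simp [hfin.resolve_left hAB]
    grind

/-- Every arc out of a scanned vertex has been traversed, so its head has been reached. -/
theorem SearchInv.head_mem (H : SearchInv L E v w σ) :
    ∀ e ∈ E ++ [(v, w)], e.1 ∈ σ.finalX L → e.2 ∈ σ.F := by
  rintro ⟨a, b⟩ he ha
  obtain ⟨i, hi⟩ := List.mem_iff_getElem?.1 he
  obtain ⟨u, x, _, h1, _, h2⟩ := H.fwd.arcs i (H.fwd.scan a (Finset.mem_filter.1 ha).1 i b hi)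
  rw [hi] at h1
  cases h1
  exact h2

theorem SearchInv.tail_mem (H : SearchInv L E v w σ) :
    ∀ e ∈ E ++ [(v, w)], e.2 ∈ σ.finalY L → e.1 ∈ σ.R := by
  rintro ⟨a, b⟩ he hb
  obtain ⟨i, hi⟩ := List.mem_iff_getElem?.1 he
  obtain ⟨u, x, _, h1, _, h2⟩ := H.bwd.arcs i
    (H.bwd.scan b (Finset.mem_filter.1 hb).1 i a (getElem?_swapArcs.2 hi))
  rw [getElem?_swapArcs, hi] at h1
  cases h1
  exact h2

/-- The predicate `low` cuts the order at the final threshold and leaves open on which side the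
threshold itself falls, so both reinsertions are instances. -/
theorem SearchInv.finish (H : SearchInv L E v w σ) (hE : Topological L E) (hL : L.Nodup)
    (hc : ∀ x, x ∈ L) (hfin : σ.Finished) {low : V → Prop} {P Q OX OY : List V}
    (hlow : ∀ a b, Lt L a b → low b → low a)
    (hlt : ∀ x, Lt L x σ.finalThreshold → low x) (hgt : ∀ x, Lt L σ.finalThreshold x → ¬ low x)
    (hF : σ.finalThreshold ∈ σ.F → ¬ low σ.finalThreshold)
    (hR : σ.finalThreshold ∈ σ.R → low σ.finalThreshold)
    (hOX : IsTopOrder (E ++ [(v, w)]) (σ.finalX L) OX)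
    (hOY : IsTopOrder (E ++ [(v, w)]) (σ.finalY L) OY)
    (hPQ : (L.filter fun a => decide (a ∉ σ.finalX L ∪ σ.finalY L)) = P ++ Q)
    (hP : ∀ x ∈ P, low x) (hQ : ∀ x ∈ Q, ¬ low x) :
    (P ++ (OY ++ (OX ++ Q))).Nodup ∧ (∀ x, x ∈ P ++ (OY ++ (OX ++ Q))) ∧
      Topological (P ++ (OY ++ (OX ++ Q))) (E ++ [(v, w)]) := by
  have htri : ∀ x, Lt L x σ.finalThreshold ∨ x = σ.finalThreshold ∨ Lt L σ.finalThreshold x := by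
    intro x
    rw [lt_iff_pos, lt_iff_pos, ← (pos_injective hc).eq_iff]
    exact lt_trichotomy _ _
  refine reorder_isTopological hL hc ?_ H.bwd.start H.fwd.start H.disjoint hlow
    (fun x hx => H.fwd.scannedF x (Finset.mem_filter.1 hx).1)
    (fun x hx => hlt x (Finset.mem_filter.1 hx).2)
    (fun x hx => hgt x (Finset.mem_filter.1 hx).2) ?_ ?_ H.head_mem H.tail_mem hOX hOY hPQ hP hQ
  · intro e he
    rcases List.mem_append.1 he with he | he
    · exact .inl (hE e he)
    · exact .inr (List.mem_singleton.1 he)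
  · intro x hx hl
    rcases htri x with h | rfl | h
    · exact H.mem_X hx h
    · exact absurd hl (hF hx)
    · exact absurd hl (hgt x h)
  · intro y hy hl
    rcases htri y with h | rfl | h
    · exact absurd (hlt y h) hl
    · exact absurd (hR hy) hl
    · exact H.mem_Y hfin hy h

theorem SearchInv.finishAfter (H : SearchInv L E v w σ) (hE : Topological L E) (hL : L.Nodup)
    (hc : ∀ x, x ∈ L) (hfin : σ.Finished) (hs : σ.finalThreshold ∉ σ.F) {OX OY p q : List V}
    (hOX : IsTopOrder (E ++ [(v, w)]) (σ.finalX L) OX)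
    (hOY : IsTopOrder (E ++ [(v, w)]) (σ.finalY L) OY)
    (hpq : (L.filter fun a => decide (a ∉ σ.finalX L ∪ σ.finalY L))
        = p ++ σ.finalThreshold :: q) :
    (p ++ σ.finalThreshold :: (OY ++ OX ++ q)).Nodup ∧
      (∀ x, x ∈ p ++ σ.finalThreshold :: (OY ++ OX ++ q)) ∧
      Topological (p ++ σ.finalThreshold :: (OY ++ OX ++ q)) (E ++ [(v, w)]) := by
  have hsub : (p ++ σ.finalThreshold :: q).Sublist L := hpq ▸ List.filter_sublist
  have e : p ++ σ.finalThreshold :: (OY ++ OX ++ q)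
      = (p ++ [σ.finalThreshold]) ++ (OY ++ (OX ++ q)) := by simp
  rw [e]
  refine H.finish (low := fun x => pos L x ≤ pos L σ.finalThreshold) hE hL hc hfin
    ?_ ?_ ?_ (fun h => absurd h hs) (fun _ => le_rfl) hOX hOY (by simpa using hpq) ?_ ?_
  · intro a b h; rw [lt_iff_pos] at h; grind
  · intro a h; rw [lt_iff_pos] at h; grind
  · intro a h; rw [lt_iff_pos] at h; grind
  · intro x hx
    rcases List.mem_append.1 hx with hx | hx
    · refine (lt_iff_pos.1 (.of_sublist hL (List.Sublist.trans ?_ hsub))).le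
      exact (List.singleton_sublist.2 hx).append
        (List.singleton_sublist.2 List.mem_cons_self)
    · rw [List.mem_singleton.1 hx]
  · intro x hx
    refine (lt_iff_pos.1 (.of_sublist hL (List.Sublist.trans ?_ hsub))).not_ge
    exact (List.Sublist.cons_cons _ (List.singleton_sublist.2 hx)).trans
      (List.sublist_append_right _ _)

theorem SearchInv.finishBefore (H : SearchInv L E v w σ) (hE : Topological L E) (hL : L.Nodup)
    (hc : ∀ x, x ∈ L) (hfin : σ.Finished) (hs : σ.finalThreshold ∉ σ.R) {OX OY p q : List V}
    (hOX : IsTopOrder (E ++ [(v, w)]) (σ.finalX L) OX)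
    (hOY : IsTopOrder (E ++ [(v, w)]) (σ.finalY L) OY)
    (hpq : (L.filter fun a => decide (a ∉ σ.finalX L ∪ σ.finalY L))
        = p ++ σ.finalThreshold :: q) :
    (p ++ (OY ++ OX) ++ σ.finalThreshold :: q).Nodup ∧
      (∀ x, x ∈ p ++ (OY ++ OX) ++ σ.finalThreshold :: q) ∧
      Topological (p ++ (OY ++ OX) ++ σ.finalThreshold :: q) (E ++ [(v, w)]) := by
  have hsub : (p ++ σ.finalThreshold :: q).Sublist L := hpq ▸ List.filter_sublist
  have e : p ++ (OY ++ OX) ++ σ.finalThreshold :: q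
      = p ++ (OY ++ (OX ++ σ.finalThreshold :: q)) := by simp
  rw [e]
  refine H.finish (low := fun x => pos L x < pos L σ.finalThreshold) hE hL hc hfin
    ?_ ?_ ?_ (fun _ => lt_irrefl _) (fun h => absurd h hs) hOX hOY hpq ?_ ?_
  · intro a b h; rw [lt_iff_pos] at h; grind
  · intro a h; rw [lt_iff_pos] at h; grind
  · intro a h; rw [lt_iff_pos] at h; grind
  · intro x hx
    refine lt_iff_pos.1 (.of_sublist hL (List.Sublist.trans ?_ hsub))
    exact (List.singleton_sublist.2 hx).append
      (List.singleton_sublist.2 List.mem_cons_self)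
  · intro x hx
    rcases List.mem_cons.1 hx with rfl | hx
    · exact lt_irrefl _
    refine (lt_iff_pos.1 (.of_sublist hL (List.Sublist.trans ?_ hsub))).not_gt
    exact (List.Sublist.cons_cons _ (List.singleton_sublist.2 hx)).trans
      (List.sublist_append_right _ _)

end Finish

/-- A step within a search preserves the invariant. -/
theorem Inv.of_searching {L : List V} {E : List (V × V)} {t t' : ℕ} {σ σ' : Search V}
    (H : Inv ⟨L, E, .searching σ, t⟩)
    (h : ∀ E' v w, E = E' ++ [(v, w)] → Topological L E' → SearchInv L E' v w σ →
      SearchInv L E' v w σ') : Inv ⟨L, E, .searching σ', t'⟩ := by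
  refine ⟨H.nodup, H.complete, fun h => by simp at h, ?_⟩
  intro σ'' hσ
  cases hσ
  obtain ⟨E', v, w, h1, h2, h3, h4⟩ := H.searching σ rfl
  exact ⟨E', v, w, h1, h2, h3, h _ _ _ h1 h2 h4⟩

theorem Inv.step {c d : Config V} (H : Inv c) (h : Step c d) : Inv d := by
  cases h with
  | addForward L E t v w hvw =>
    refine ⟨H.nodup, H.complete, fun _ e he => ?_, fun σ h => by simp at h⟩
    rcases List.mem_append.1 he with he | he
    · exact H.idle rfl e he
    · rw [List.mem_singleton.1 he]; exact hvw
  | addLoop L E t v =>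
    exact ⟨H.nodup, H.complete, fun h => by simp at h, fun σ h => by simp at h⟩
  | addBackward L E t v w s hwv hws hsv =>
    refine ⟨H.nodup, H.complete, fun h => by simp at h, fun σ h => ?_⟩
    cases h
    exact ⟨E, v, w, rfl, H.idle rfl, hwv, SearchInv.start L E hwv hws hsv⟩
  | case2f L E t σ u z hu hz h2 => exact H.of_searching fun _ _ _ _ _ I => I.case2f h2
  | case2b L E t σ u z hu hz h2 => exact H.of_searching fun _ _ _ _ _ I => I.case2b h2
  | case3f L E t σ u z hu hz huh hlz h3 =>
    exact H.of_searching fun _ _ _ _ _ I => I.case3f hu hlz h3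
  | case3b L E t σ u z hu hz huh hlz h3 =>
    exact H.of_searching fun _ _ _ _ _ I => I.case3b hz huh h3
  | case4f L E t σ u z hu hz huh hlz huz h4 =>
    exact H.of_searching fun _ _ _ e _ I => I.case4f hu (e ▸ h4)
  | case4b L E t σ u z hu hz huh hlz huz h4 =>
    exact H.of_searching fun _ _ _ e _ I => I.case4b hz (e ▸ h4)
  | case5 L E t σ u z hu hz huh hlz huz i j x y hi hiT hj hjT hx hy hxy =>
    exact H.of_searching fun _ _ _ e hE I =>
      I.case5 hE hu hz huz (e ▸ hi) hiT (e ▸ hj) hjT hx hy hxy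
  | case5cycle L E t σ u z hu hz huh hlz huz i j x y hi hiT hj hjT hcyc =>
    exact ⟨H.nodup, H.complete, fun h => by simp at h, fun σ h => by simp at h⟩
  | finishAfter L E t σ hfin hs OX OY p q hOX hOY hpq =>
    obtain ⟨E', v, w, rfl, h2, h3, h4⟩ := H.searching σ rfl
    obtain ⟨k1, k2, k3⟩ := h4.finishAfter h2 H.nodup H.complete hfin hs hOX hOY hpq
    exact ⟨k1, k2, fun _ => k3, fun σ h => by simp at h⟩
  | finishBefore L E t σ hfin hs OX OY p q hOX hOY hpq =>
    obtain ⟨E', v, w, rfl, h2, h3, h4⟩ := H.searching σ rfl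
    obtain ⟨k1, k2, k3⟩ := h4.finishBefore h2 H.nodup H.complete hfin hs hOX hOY hpq
    exact ⟨k1, k2, fun _ => k3, fun σ h => by simp at h⟩

theorem Inv.refill {c : Config V} {G : Finset V} {next : V → Config V} (H : Inv c)
    (h : Refill c G next) {a : V} (ha : a ∈ G) : Inv (next a) := by
  cases h with
  | fwd L E t σ hfin hA => exact H.of_searching fun _ _ _ _ _ I => I.refillF hA ha
  | bwd L E t σ hfin hC => exact H.of_searching fun _ _ _ _ _ I => I.refillB hC ha

theorem Run.inv {P : List V → Finset V → V → Prop} {c d : Config V} (H : Inv c)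
    (h : Run P c d) : Inv d := by
  induction h with
  | refl => exact H
  | step d d' _ h ih => exact ih.step h
  | refill d G next a _ h ha _ ih => exact ih.refill h ha

theorem SearchInv.exists_finish {L : List V} {E : List (V × V)} {v w : V} {σ : Search V}
    (H : SearchInv L E v w σ) (hE : Topological L E) (hL : L.Nodup) (hc : ∀ x, x ∈ L)
    (hfin : σ.Finished) (t : ℕ) : ∃ d, Step ⟨L, E ++ [(v, w)], .searching σ, t⟩ d := by
  obtain ⟨OX, hOX⟩ : ∃ O, IsTopOrder (E ++ [(v, w)]) (σ.finalX L) O := by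
    refine exists_isTopOrder hL hc fun e he h1 h2 => ?_
    rcases List.mem_append.1 he with he | he
    · exact hE e he
    · rw [List.mem_singleton.1 he] at h1
      exact absurd H.bwd.start (H.disjoint _ (H.fwd.scannedF _ (Finset.mem_filter.1 h1).1))
  obtain ⟨OY, hOY⟩ : ∃ O, IsTopOrder (E ++ [(v, w)]) (σ.finalY L) O := by
    refine exists_isTopOrder hL hc fun e he h1 h2 => ?_
    rcases List.mem_append.1 he with he | he
    · exact hE e he
    · rw [List.mem_singleton.1 he] at h2
      exact absurd (H.bwd.scannedF _ (Finset.mem_filter.1 h2).1) (H.disjoint _ H.fwd.start)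
  have hmem : σ.finalThreshold ∈ L.filter fun a => decide (a ∉ σ.finalX L ∪ σ.finalY L) := by
    have h1 : σ.finalThreshold ∉ σ.finalX L := fun h => lt_irrefl _ (Finset.mem_filter.1 h).2
    have h2 : σ.finalThreshold ∉ σ.finalY L := fun h => lt_irrefl _ (Finset.mem_filter.1 h).2
    simp [hc, h1, h2]
  obtain ⟨p, q, hpq⟩ := List.append_of_mem hmem
  by_cases hs : σ.finalThreshold ∈ σ.F
  · exact ⟨_, .finishBefore _ _ _ _ hfin (H.disjoint _ hs) OX OY p q hOX hOY hpq⟩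
  · exact ⟨_, .finishAfter _ _ _ _ hfin hs OX OY p q hOX hOY hpq⟩

theorem Inv.canContinue {c : Config V} (H : Inv c) {σ : Search V}
    (hσ : c.phase = .searching σ) : CanContinue c := by
  obtain ⟨L, E, phase, t⟩ := c
  cases hσ
  obtain ⟨E', v, w, rfl, hE, hwv, I⟩ := H.searching σ rfl
  by_cases hfin : σ.Finished
  · exact .inl (I.exists_finish hE H.nodup H.complete hfin t)
  by_cases hA : σ.A = ∅
  · refine .inr ⟨_, _, ?_, .fwd _ _ _ _ hfin hA⟩
    by_contra h
    exact hfin (.inl (by simpa [hA] using h))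
  by_cases hC : σ.C = ∅
  · refine .inr ⟨_, _, ?_, .bwd _ _ _ _ hfin hC⟩
    by_contra h
    exact hfin (.inr (by simpa [hC] using h))
  left
  obtain ⟨u, hu⟩ := Finset.nonempty_iff_ne_empty.2 hA
  obtain ⟨z, hz⟩ := Finset.nonempty_iff_ne_empty.2 hC
  by_cases h2f : Le L σ.h u
  · exact ⟨_, .case2f _ _ _ _ u z hu hz h2f⟩
  by_cases h2b : Le L z σ.l
  · exact ⟨_, .case2b _ _ _ _ u z hu hz h2b⟩
  have huh : Lt L u σ.h := not_le.1 h2f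
  have hlz : Lt L σ.l z := not_le.1 h2b
  by_cases h3f : Le L (vmax L z σ.s) u
  · exact ⟨_, .case3f _ _ _ _ u z hu hz huh hlz h3f⟩
  by_cases h3b : Le L z (vmin L u σ.s)
  · exact ⟨_, .case3b _ _ _ _ u z hu hz huh hlz h3b⟩
  -- If z ≤ u, then either s ≤ u and Case 3f applies, or z ≤ u < s and Case 3b applies.
  have huz : Lt L u z := by
    rw [le_iff_pos, pos_vmax] at h3f
    rw [le_iff_pos, pos_vmin] at h3b
    rw [lt_iff_pos]
    omega
  by_cases h4f : ∀ (i : ℕ) (x : V), (E' ++ [(v, w)])[i]? = some (u, x) → i ∈ σ.TF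
  · exact ⟨_, .case4f _ _ _ _ u z hu hz huh hlz huz h4f⟩
  by_cases h4b : ∀ (j : ℕ) (y : V), (E' ++ [(v, w)])[j]? = some (y, z) → j ∈ σ.TR
  · exact ⟨_, .case4b _ _ _ _ u z hu hz huh hlz huz h4b⟩
  push Not at h4f h4b
  obtain ⟨i, x, hi, hiT⟩ := h4f
  obtain ⟨j, y, hj, hjT⟩ := h4b
  by_cases hcyc : x ∈ σ.R ∨ y ∈ σ.F ∨ x = y
  · exact ⟨_, .case5cycle _ _ _ _ u z hu hz huh hlz huz i j x y hi hiT hj hjT hcyc⟩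
  · push Not at hcyc
    exact ⟨_, .case5 _ _ _ _ u z hu hz huh hlz huz i j x y hi hiT hj hjT hcyc.1 hcyc.2.1 hcyc.2.2⟩

end Invariant

/-! ### Counting related pairs of arcs. -/

section Related

variable {V : Type*} [DecidableEq V]

open Classical in
/-- The pairs of arcs such that the second can be reached from the first. -/
noncomputable def relatedPairs (E : List (V × V)) : Finset (ℕ × ℕ) :=
  (Finset.range E.length ×ˢ Finset.range E.length).filter fun ij : ℕ × ℕ =>
    ∃ e e' : V × V, E[ij.1]? = some e ∧ E[ij.2]? = some e' ∧ Reach E e.2 e'.1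

theorem card_relatedPairs_le (E : List (V × V)) : (relatedPairs E).card ≤ E.length ^ 2 := by
  classical
  refine (Finset.card_filter_le _ _).trans ?_
  simp [sq]

theorem mem_relatedPairs {E : List (V × V)} {i j : ℕ} {e e' : V × V} (hi : E[i]? = some e)
    (hj : E[j]? = some e') : (i, j) ∈ relatedPairs E ↔ Reach E e.2 e'.1 := by
  obtain ⟨h1, rfl⟩ := List.getElem?_eq_some_iff.1 hi
  obtain ⟨h2, rfl⟩ := List.getElem?_eq_some_iff.1 hj
  simp [relatedPairs, h1, h2]

theorem relatedPairs_subset (E : List (V × V)) (e : V × V) :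
    relatedPairs E ⊆ relatedPairs (E ++ [e]) := by
  intro ⟨i, j⟩ h
  have h' := h
  simp only [relatedPairs, Finset.mem_filter] at h'
  obtain ⟨_, a, b, hi, hj, hr⟩ := h'
  have hi' : (E ++ [e])[i]? = some a := by
    rw [List.getElem?_append_left (List.getElem?_eq_some_iff.1 hi).1, hi]
  have hj' : (E ++ [e])[j]? = some b := by
    rw [List.getElem?_append_left (List.getElem?_eq_some_iff.1 hj).1, hj]
  exact (mem_relatedPairs hi' hj').2 (hr.mono fun _ h => List.mem_append_left _ h)

theorem Topological.pos_le {L : List V} {E : List (V × V)} (hE : Topological L E) {x y : V}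
    (h : Reach E x y) : pos L x ≤ pos L y := by
  induction h with
  | refl => exact le_rfl
  | tail _ h ih => exact ih.trans (lt_iff_pos.1 (hE _ h)).le

/-- A search makes many pairs of arcs related. -/
theorem SearchInv.card_relatedPairs {L : List V} {E : List (V × V)} {v w : V} {σ : Search V}
    (H : SearchInv L E v w σ) (hE : Topological L E) :
    σ.TF.card ^ 2 + 2 * (relatedPairs E).card ≤ 2 * (relatedPairs (E ++ [(v, w)])).card := by
  classical
  obtain ⟨T, h1, h2, h3, h4, h5⟩ := H.compatible
  have i1 : Set.InjOn Prod.fst (T : Set (ℕ × ℕ)) := Finset.card_image_iff.1 (by rw [h1, h3])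
  have i2 : Set.InjOn Prod.snd (T : Set (ℕ × ℕ)) := Finset.card_image_iff.1 (by rw [h2, h4])
  have hF : ∀ p ∈ T, ∃ u x, E[p.1]? = some (u, x) ∧ (E ++ [(v, w)])[p.1]? = some (u, x) ∧
      u ∈ σ.F ∧ x ∈ σ.F := fun p hp => H.fwd.arcs _ (h1 ▸ Finset.mem_image_of_mem _ hp)
  have hR : ∀ p ∈ T, ∃ y z, E[p.2]? = some (y, z) ∧ (E ++ [(v, w)])[p.2]? = some (y, z) ∧
      z ∈ σ.R := by
    intro p hp
    obtain ⟨z, y, k1, k2, k3, _⟩ := H.bwd.arcs p.2 (h2 ▸ Finset.mem_image_of_mem _ hp)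
    exact ⟨y, z, getElem?_swapArcs.1 k1, getElem?_swapArcs.1 k2, k3⟩
  let compat : (ℕ × ℕ) × (ℕ × ℕ) → Prop := fun pp => ∀ u x y z,
    E[pp.1.1]? = some (u, x) → E[pp.2.2]? = some (y, z) → pos L u < pos L z
  let P := (T ×ˢ T).filter compat
  -- If u < z' fails, then u' < z' ≤ u < z, so the other crossing is compatible.
  have hP : T ×ˢ T ⊆ P ∪ P.image Prod.swap := by
    rintro ⟨p, p'⟩ hpp
    obtain ⟨hp, hp'⟩ := Finset.mem_product.1 hpp
    obtain ⟨u, x, a1, -, -⟩ := hF p hp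
    obtain ⟨y, z, a2, -, -⟩ := hR p hp
    obtain ⟨u', x', a1', -, -⟩ := hF p' hp'
    obtain ⟨y', z', a2', -, -⟩ := hR p' hp'
    have b := h5 p hp _ _ _ _ a1 a2
    have b' := h5 p' hp' _ _ _ _ a1' a2'
    simp only [P, Finset.mem_union, Finset.mem_filter, Finset.mem_image, compat]
    by_cases hc : pos L u < pos L z'
    · left
      refine ⟨hpp, fun u₁ x₁ y₁ z₁ c1 c2 => ?_⟩
      rw [a1] at c1; rw [a2'] at c2
      cases c1; cases c2
      exact hc
    · right
      refine ⟨(p', p), ⟨Finset.mem_product.2 ⟨hp', hp⟩, fun u₁ x₁ y₁ z₁ c1 c2 => ?_⟩, rfl⟩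
      rw [a1'] at c1; rw [a2] at c2
      cases c1; cases c2
      omega
  have hPc : T.card ^ 2 ≤ 2 * P.card := by
    have := (Finset.card_le_card hP).trans (Finset.card_union_le _ _)
    rw [Finset.card_product] at this
    have := Finset.card_image_le (s := P) (f := Prod.swap)
    nlinarith
  -- The backward arc of one match leads through `v`, the new arc and `w` to the forward arc of the
  -- other. Before the addition, a path from its head z to u would force z ≤ u.
  have hmap : P.card ≤ (relatedPairs (E ++ [(v, w)]) \ relatedPairs E).card := by
    refine Finset.card_le_card_of_injOn (fun pp => (pp.2.2, pp.1.1)) ?_ ?_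
    · rintro ⟨p, p'⟩ hpp
      obtain ⟨hpp, hc⟩ := Finset.mem_filter.1 (Finset.mem_coe.1 hpp)
      obtain ⟨hp, hp'⟩ := Finset.mem_product.1 hpp
      obtain ⟨u, x, a1, a2, a3, -⟩ := hF p hp
      obtain ⟨y, z, b1, b2, b3⟩ := hR p' hp'
      refine Finset.mem_coe.2 (Finset.mem_sdiff.2 ⟨?_, ?_⟩)
      · refine (mem_relatedPairs b2 a2).2 ?_
        have r1 : Reach (E ++ [(v, w)]) z v :=
          (reach_swapArcs.1 (H.bwd.reach z b3)).mono fun _ h => List.mem_append_left _ h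
        have r2 : Reach (E ++ [(v, w)]) w u :=
          (H.fwd.reach u a3).mono fun _ h => List.mem_append_left _ h
        exact (r1.tail (by simp)).trans r2
      · intro h
        exact (hc _ _ _ _ a1 b1).not_ge (hE.pos_le ((mem_relatedPairs b1 a1).1 h))
    · rintro ⟨p, p'⟩ hpp ⟨r, r'⟩ hrr heq
      have hp := Finset.mem_product.1 (Finset.mem_filter.1 (Finset.mem_coe.1 hpp)).1
      have hr := Finset.mem_product.1 (Finset.mem_filter.1 (Finset.mem_coe.1 hrr)).1
      simp only [Prod.mk.injEq] at heq
      rw [Prod.mk.injEq]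
      exact ⟨i1 hp.1 hr.1 heq.2, i2 hp.2 hr.2 heq.1⟩
  have := Finset.card_sdiff_add_card_eq_card (relatedPairs_subset E (v, w))
  rw [← h3]
  omega

end Related

/-! ### Amortized time: budgets and excess. -/

section Time

variable {V : Type*} [DecidableEq V]

/-- The potential of a search. -/
noncomputable def Search.potential (κ : ℝ) (L : List V) (σ : Search V) : ℝ :=
  IncTopo.potential κ (pos L) σ.A σ.B (pos L σ.l) (pos L σ.s) (pos L σ.h)
    + IncTopo.potential κ (fun x => -pos L x) σ.C σ.D (-pos L σ.h) (-pos L σ.s) (-pos L σ.l)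

/-- A bound for the amortized time of the additions of the arcs `E`. -/
noncomputable def arcBudget (κ q : ℝ) (E : List (V × V)) : ℝ :=
  (4 * κ + 14) * ((1 + q) * E.length + (relatedPairs E).card / q)

/-- The excess of the time spent over what the arcs added and the traversals pay. -/
noncomputable def excess (κ q : ℝ) (c : Config V) : ℝ :=
  match c.phase with
  | .idle => c.time - arcBudget κ q c.arcs
  | .searching σ => c.time + σ.potential κ c.order - arcBudget κ q c.arcs.dropLast
      - (4 * κ + 6) * (σ.TF.card + 1)
  | .stopped => c.time - arcBudget κ q c.arcs.dropLast - (4 * κ + 14) * c.arcs.length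

variable {κ q : ℝ} {L : List V} {E : List (V × V)} {t : ℕ} {v w : V} {σ : Search V}

theorem Search.potential_nonneg (hκ : 0 ≤ κ) (L : List V) (σ : Search V) :
    0 ≤ σ.potential κ L :=
  add_nonneg (IncTopo.potential_nonneg hκ ..) (IncTopo.potential_nonneg hκ ..)

theorem SearchInv.card_TF_le (H : SearchInv L E v w σ) : σ.TF.card ≤ E.length := by
  rw [← Finset.card_range E.length]
  refine Finset.card_le_card fun i hi => ?_
  obtain ⟨u, x, h, -⟩ := H.fwd.arcs i hi
  exact Finset.mem_range.2 (List.getElem?_eq_some_iff.1 h).1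

theorem SearchInv.card_TR (H : SearchInv L E v w σ) : σ.TR.card = σ.TF.card := by
  obtain ⟨T, -, -, h3, h4, -⟩ := H.compatible
  rw [← h3, ← h4]

theorem countP_le_card (p : V × V → Bool) (E : List (V × V)) (S : Finset ℕ)
    (h : ∀ i e, E[i]? = some e → p e → i ∈ S) : E.countP p ≤ S.card := by
  induction E using List.reverseRecOn generalizing S with
  | nil => simp
  | append_singleton E e ih =>
    rw [List.countP_append, List.countP_singleton]
    have hlt : ∀ i e', E[i]? = some e' → (E ++ [e])[i]? = some e' := fun i e' hi => by
      rw [List.getElem?_append_left (List.getElem?_eq_some_iff.1 hi).1, hi]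
    split_ifs with hp
    · have hS : E.length ∈ S := h _ e (by simp) hp
      rw [← Finset.card_erase_add_one hS]
      gcongr
      refine ih _ fun i e' hi hpe => Finset.mem_erase.2 ⟨?_, h i e' (hlt _ _ hi) hpe⟩
      exact (List.getElem?_eq_some_iff.1 hi).1.ne
    · exact ih _ fun i e' hi hpe => h i e' (hlt _ _ hi) hpe

/-- Each direction reaches at most one vertex more than it traverses arcs, and all arcs out of the
final `X` and into the final `Y` were traversed. With k traversals each way the cost is at most 8k +
7. -/
theorem SearchInv.finishCost_le (H : SearchInv L E v w σ) :
    σ.finishCost L (E ++ [(v, w)]) ≤ 8 * (σ.TF.card + 1) := by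
  have h1 : σ.X.card ≤ σ.F.card := Finset.card_le_card H.fwd.scannedF
  have h2 : σ.Y.card ≤ σ.R.card := Finset.card_le_card H.bwd.scannedF
  have h3 : (σ.finalX L).card ≤ σ.X.card := Finset.card_filter_le _ _
  have h4 : (σ.finalY L).card ≤ σ.Y.card := Finset.card_filter_le _ _
  have h5 := H.fwd.card
  have h6 := H.bwd.card
  have h7 := H.card_TR
  have h8 : arcsOut (E ++ [(v, w)]) (σ.finalX L) ≤ σ.TF.card :=
    countP_le_card _ _ _ fun i e hi he =>
      H.fwd.scan e.1 (Finset.mem_filter.1 (of_decide_eq_true he)).1 i e.2 hi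
  have h9 : arcsInto (E ++ [(v, w)]) (σ.finalY L) ≤ σ.TR.card :=
    countP_le_card _ _ _ fun i e hi he =>
      H.bwd.scan e.2 (Finset.mem_filter.1 (of_decide_eq_true he)).1 i e.1 (getElem?_swapArcs.2 hi)
  unfold Search.finishCost
  omega

theorem arcBudget_append (hκ : 0 ≤ κ) (hq : 0 < q) (E : List (V × V)) (e : V × V) :
    arcBudget κ q E + (4 * κ + 14) ≤ arcBudget κ q (E ++ [e]) := by
  unfold arcBudget
  have h : ((relatedPairs E).card : ℝ) / q ≤ (relatedPairs (E ++ [e])).card / q := by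
    gcongr
    exact relatedPairs_subset E e
  have h2 := mul_le_mul_of_nonneg_left h (by linarith : 0 ≤ 4 * κ + 14)
  have h3 : 0 ≤ (4 * κ + 14) * q := by positivity
  rw [List.length_append, List.length_singleton]
  push_cast
  nlinarith

theorem SearchInv.arcBudget_append (H : SearchInv L E v w σ) (hE : Topological L E) (hκ : 0 ≤ κ)
    (hq : 0 < q) :
    arcBudget κ q E + (4 * κ + 14) * (σ.TF.card + 1) ≤ arcBudget κ q (E ++ [(v, w)]) := by
  have h1 : (σ.TF.card : ℝ) ^ 2 + 2 * (relatedPairs E).card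
      ≤ 2 * (relatedPairs (E ++ [(v, w)])).card := by exact_mod_cast H.card_relatedPairs hE
  -- This is k ≤ q + k²/(2q): a search of up to about q traversals is paid by its arc, a longer one
  -- by the pairs it makes related.
  have h2 : (σ.TF.card : ℝ) + (relatedPairs E).card / q
      ≤ q + (relatedPairs (E ++ [(v, w)])).card / q := by
    rw [← mul_le_mul_iff_of_pos_right hq, add_mul, add_mul, div_mul_cancel₀ _ hq.ne',
      div_mul_cancel₀ _ hq.ne']
    nlinarith [sq_nonneg ((σ.TF.card : ℝ) - q)]
  unfold arcBudget
  rw [← mul_add, List.length_append, List.length_singleton]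
  refine mul_le_mul_of_nonneg_left ?_ (by linarith)
  push_cast
  linarith

theorem arcBudget_nil : arcBudget κ q ([] : List (V × V)) = 0 := by
  have : relatedPairs ([] : List (V × V)) = ∅ := by simp [relatedPairs]
  simp [arcBudget, this]

/-- A step within a search that costs one unit of time and decreases the potential. -/
theorem excess_le_of_potential {σ' : Search V} (hT : σ'.TF = σ.TF)
    (h : σ'.potential κ L + 1 ≤ σ.potential κ L) :
    excess κ q ⟨L, E, .searching σ', t + 1⟩ ≤ excess κ q ⟨L, E, .searching σ, t⟩ := by
  simp only [excess, hT]
  push_cast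
  linarith

theorem excess_finish (H : Inv ⟨L, E, .searching σ, t⟩) (hκ : 0 ≤ κ) (hq : 0 < q) (L' : List V) :
    excess κ q ⟨L', E, .idle, t + σ.finishCost L E⟩ ≤ excess κ q ⟨L, E, .searching σ, t⟩ := by
  obtain ⟨E', v, w, rfl, h2, h3, I⟩ := H.searching σ rfl
  have h4 : (σ.finishCost L (E' ++ [(v, w)]) : ℝ) ≤ 8 * (σ.TF.card + 1) := by
    exact_mod_cast I.finishCost_le
  have h5 := I.arcBudget_append h2 hκ hq
  have h6 := σ.potential_nonneg hκ L
  simp only [excess, List.dropLast_concat]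
  push_cast
  linarith

theorem Step.excess_le {c d : Config V} (h : Step c d) (H : Inv c) (hκ : 0 ≤ κ) (hq : 0 < q) :
    excess κ q d ≤ excess κ q c := by
  cases h with
  | addForward L E t v w hvw =>
    have := arcBudget_append hκ hq E (v, w)
    simp only [excess]
    push_cast
    linarith
  | addLoop L E t v =>
    have h : (0 : ℝ) ≤ (4 * κ + 14) * E.length := by positivity
    simp only [excess, List.dropLast_concat, List.length_append, List.length_singleton]
    push_cast
    linarith
  | addBackward L E t v w s hwv hws hsv =>
    have h : Search.potential κ L (Search.start v w s) = 2 := by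
      rw [Search.potential, Search.start, potential_singleton _ _ (le_iff_pos.1 hws),
        potential_singleton _ (fun x => -pos L x) (neg_le_neg (le_iff_pos.1 hsv))]
      norm_num
    simp only [excess, List.dropLast_concat, h]
    simp only [Search.start, Finset.card_empty]
    push_cast
    linarith
  | case2f L E t σ u z hu hz h2 =>
    exact excess_le_of_potential rfl (by
      have := potential_erase hκ (pos L) σ.B (pos L σ.l) (pos L σ.s) (pos L σ.h) hu
      unfold Search.potential; linarith)
  | case2b L E t σ u z hu hz h2 =>
    exact excess_le_of_potential rfl (by
      have := potential_erase hκ (fun x => -pos L x) σ.D (-pos L σ.h) (-pos L σ.s) (-pos L σ.l) hz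
      unfold Search.potential; linarith)
  | case3f L E t σ u z hu hz huh hlz h3 =>
    rw [le_iff_pos, pos_vmax, max_le_iff] at h3
    exact excess_le_of_potential rfl (by
      have := potential_move hκ (pos L) σ.B (pos L σ.s) hu ((lt_iff_pos.1 hlz).trans_le h3.1)
        (lt_iff_pos.1 huh)
      unfold Search.potential; linarith)
  | case3b L E t σ u z hu hz huh hlz h3 =>
    rw [le_iff_pos, pos_vmin, le_min_iff] at h3
    exact excess_le_of_potential rfl (by
      have := potential_move hκ (fun x => -pos L x) σ.D (-pos L σ.s) hz
        (neg_lt_neg (h3.1.trans_lt (lt_iff_pos.1 huh))) (neg_lt_neg (lt_iff_pos.1 hlz))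
      unfold Search.potential; linarith)
  | case4f L E t σ u z hu hz huh hlz huz h4 =>
    exact excess_le_of_potential rfl (by
      have := potential_erase hκ (pos L) σ.B (pos L σ.l) (pos L σ.s) (pos L σ.h) hu
      unfold Search.potential; linarith)
  | case4b L E t σ u z hu hz huh hlz huz h4 =>
    exact excess_le_of_potential rfl (by
      have := potential_erase hκ (fun x => -pos L x) σ.D (-pos L σ.h) (-pos L σ.s) (-pos L σ.l) hz
      unfold Search.potential; linarith)
  | case5 L E t σ u z hu hz huh hlz huz i j x y hi hiT hj hjT hx hy hxy =>
    have h1 := potential_insert hκ (pos L) σ.A σ.B (pos L σ.l) (pos L σ.s) (pos L σ.h) x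
    have h2 := potential_insert hκ (fun x => -pos L x) σ.C σ.D (-pos L σ.h) (-pos L σ.s)
      (-pos L σ.l) y
    -- Two insertions of `2 * κ + 2` and two units of time give the price `4 * κ + 6` of a traversal
    -- step. Adding 8 for the final reordering gives `4 * κ + 14`.
    have h : (σ.traverse i j x y).potential κ L ≤ σ.potential κ L + (4 * κ + 4) := by
      simp only [Search.potential, Search.traverse]
      split_ifs <;> linarith
    have hT : ((σ.traverse i j x y).TF.card : ℝ) = σ.TF.card + 1 := by
      exact_mod_cast Finset.card_insert_of_notMem hiT
    simp only [excess, hT]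
    push_cast
    linarith
  | case5cycle L E t σ u z hu hz huh hlz huz i j x y hi hiT hj hjT hcyc =>
    obtain ⟨E', v, w, rfl, h2, h3, I⟩ := H.searching σ rfl
    -- No related pairs are charged here: a cycle is reported only once, so the last search may cost
    -- time linear in the number of arcs.
    have h4 : (σ.TF.card : ℝ) ≤ E'.length := by exact_mod_cast I.card_TF_le
    have h5 : (σ.F.card : ℝ) ≤ σ.TF.card + 1 := by exact_mod_cast I.fwd.card
    have h6 : (σ.R.card : ℝ) ≤ σ.TF.card + 1 := by exact_mod_cast I.card_TR ▸ I.bwd.card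
    have h7 := σ.potential_nonneg hκ L
    have h8 := mul_le_mul_of_nonneg_left h4 (by linarith : 0 ≤ 4 * κ + 14)
    simp only [excess, List.dropLast_concat, List.length_append, List.length_singleton]
    push_cast
    linarith
  | finishAfter L E t σ hfin hs OX OY p q hOX hOY hpq => exact excess_finish H hκ hq _
  | finishBefore L E t σ hfin hs OX OY p q hOX hOY hpq => exact excess_finish H hκ hq _

/-- A refill concerns only the potential of one direction. -/
theorem Refill.exists_potential {c : Config V} {G : Finset V} {next : V → Config V}
    (h : Refill c G next) (H : Inv c) (hκ : 0 ≤ κ) (q : ℝ) :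
    ∃ (f : V → ℤ) (l s h : ℤ) (r : ℝ),
      (f = pos c.order ∨ f = fun x => -pos c.order x) ∧ (∀ a ∈ G, s ≤ f a) ∧
      excess κ q c = r + potential κ f ∅ G l s h ∧
      ∀ a ∈ G, excess κ q (next a)
        ≤ r + (potential κ f G ∅ s (min (f a) h) h + (1 + G.card + G.card)) := by
  cases h with
  | fwd L E t σ hfin hA =>
    obtain ⟨E', v, w, rfl, -, -, I⟩ := H.searching σ rfl
    refine ⟨pos L, pos L σ.l, pos L σ.s, pos L σ.h, excess κ q ⟨L, E' ++ [(v, w)], .searching σ, t⟩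
      - potential κ (pos L) ∅ σ.B (pos L σ.l) (pos L σ.s) (pos L σ.h), .inl rfl,
      I.fwd.soft_le_far, by simp, fun a ha => ?_⟩
    have h1 := pos_vmin L a σ.h
    -- For the backward direction the refill only narrows the hard thresholds.
    have h2 := potential_narrow hκ (fun x => -pos L x) σ.C σ.D (l := -pos L σ.h)
      (s' := -pos L (vmin L a σ.h)) (neg_le_neg I.le_soft)
      (neg_le_neg (h1.trans_le (min_le_right _ _)))
      (neg_le_neg ((le_min (I.fwd.soft_le_far a ha) I.soft_le).trans h1.ge))
    simp only [excess, Search.potential, Search.refillF, hA] at h2 ⊢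
    rw [h1] at h2 ⊢
    push_cast
    linarith
  | bwd L E t σ hfin hC =>
    obtain ⟨E', v, w, rfl, -, -, I⟩ := H.searching σ rfl
    refine ⟨fun x => -pos L x, -pos L σ.h, -pos L σ.s, -pos L σ.l,
      excess κ q ⟨L, E' ++ [(v, w)], .searching σ, t⟩
      - potential κ (fun x => -pos L x) ∅ σ.D (-pos L σ.h) (-pos L σ.s) (-pos L σ.l), .inr rfl,
      I.bwd.soft_le_far, by simp, fun a ha => ?_⟩
    have h1 := pos_vmax L a σ.l
    have h2 := potential_narrow hκ (pos L) σ.A σ.B (l := pos L σ.l)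
      (s' := pos L (vmax L a σ.l)) I.soft_le
      ((le_max_right _ _).trans h1.ge)
      (h1.trans_le (max_le (neg_le_neg_iff.1 (I.bwd.soft_le_far a ha)) I.le_soft))
    simp only [excess, Search.potential, Search.refillB, hC] at h2 ⊢
    rw [h1] at h2 ⊢
    rw [min_neg_neg]
    push_cast
    linarith

theorem Refill.excess_le_of_isApproxMedian {ε : ℝ} (hε : 0 < ε) {c : Config V} {G : Finset V}
    {next : V → Config V} (h : Refill c G next) (H : Inv c) (q : ℝ) {a : V}
    (ha : IsApproxMedian ε c.order G a) : excess (4 / ε) q (next a) ≤ excess (4 / ε) q c := by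
  obtain ⟨f, l, s, h, r, hf, hs, e1, e2⟩ := h.exists_potential H (κ := 4 / ε) (by positivity) q
  obtain ⟨ha, h1, h2⟩ := ha
  refine (e2 a ha).trans ?_
  rw [e1]
  simp only [le_iff_pos] at h1 h2
  gcongr
  refine potential_refill_median hε f G l ha (hs a ha) ?_ ?_
  · rcases hf with rfl | rfl
    · exact h1
    · simpa only [neg_le_neg_iff] using h2
  · rcases hf with rfl | rfl
    · exact h2
    · simpa only [neg_le_neg_iff] using h1

theorem Refill.sum_excess_le {c : Config V} {G : Finset V} {next : V → Config V}
    (h : Refill c G next) (H : Inv c) (q : ℝ) :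
    ∑ a ∈ G, excess 24 q (next a) ≤ G.card * excess 24 q c := by
  obtain ⟨f, l, s, h, r, hf, hs, e1, e2⟩ := h.exists_potential H (κ := 24) (by norm_num) q
  have hinj : Function.Injective f := by
    rcases hf with rfl | rfl
    · exact pos_injective H.complete
    · exact neg_injective.comp (pos_injective H.complete)
  refine (Finset.sum_le_sum e2).trans ?_
  rw [Finset.sum_add_distrib, Finset.sum_const, nsmul_eq_mul, e1, mul_add]
  gcongr
  exact potential_refill_random hinj G l hs

theorem excess_init (κ q : ℝ) (L : List V) : excess κ q (Config.init L) = 0 := by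
  simp [excess, Config.init, arcBudget_nil]

theorem Run.excess_le {ε : ℝ} (hε : 0 < ε) {c d : Config V} (H : Inv c)
    (h : Run (IsApproxMedian ε) c d) (hq : 0 < q) :
    excess (4 / ε) q d ≤ excess (4 / ε) q c := by
  induction h with
  | refl => exact le_rfl
  | step d d' hd h ih => exact (h.excess_le (hd.inv H) (by positivity) hq).trans ih
  | refill d G next a hd h ha hP ih =>
    exact (h.excess_le_of_isApproxMedian hε (hd.inv H) q hP).trans ih

/-- The choice q = √m balances the two parts of the budget; the maximum with 1 only keeps q positive
when `m = 0`. -/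
theorem arcBudget_le (hκ : 0 ≤ κ) {m : ℕ} (hE : E.length ≤ m) :
    arcBudget κ (max 1 (Real.sqrt m)) E ≤ (4 * κ + 14) * ((1 + 2 * Real.sqrt m) * m) := by
  have hm : (E.length : ℝ) ≤ m := by exact_mod_cast hE
  have h0 : ((relatedPairs E).card : ℝ) ≤ (m : ℝ) ^ 2 := by
    have : ((relatedPairs E).card : ℝ) ≤ (E.length : ℝ) ^ 2 := by
      exact_mod_cast card_relatedPairs_le E
    exact this.trans (by gcongr)
  unfold arcBudget
  refine mul_le_mul_of_nonneg_left ?_ (by linarith)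
  rcases Nat.eq_zero_or_pos m with rfl | hpos
  · have h1 : E = [] := List.length_eq_zero_iff.1 (Nat.le_zero.1 hE)
    subst h1
    simp [relatedPairs]
  · have h1 : (1 : ℝ) ≤ Real.sqrt m := Real.one_le_sqrt.2 (by exact_mod_cast hpos)
    rw [max_eq_right h1]
    have h2 : ((relatedPairs E).card : ℝ) / Real.sqrt m ≤ Real.sqrt m * m := by
      rw [div_le_iff₀ (by linarith)]
      nlinarith [Real.mul_self_sqrt (Nat.cast_nonneg (α := ℝ) m)]
    have h3 : (1 + Real.sqrt m) * E.length ≤ (1 + Real.sqrt m) * m := by gcongr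
    linarith

/-- The time is bounded by the excess and a bound for the total payment. -/
theorem Inv.time_le {c : Config V} (H : Inv c) (hκ : 0 ≤ κ) {m : ℕ} (hm : c.arcs.length ≤ m) :
    (c.time : ℝ) ≤ excess κ (max 1 (Real.sqrt m)) c
      + (16 * κ + 56) * Real.sqrt m * m := by
  obtain ⟨L, E, phase, t⟩ := c
  simp only at hm
  have hm' : (E.length : ℝ) ≤ m := by exact_mod_cast hm
  have hd := arcBudget_le (κ := κ) hκ (E := E.dropLast) (m := m) (by simp; omega)
  have he := arcBudget_le (κ := κ) hκ hm
  have hs : (m : ℝ) ≤ Real.sqrt m * m := by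
    rcases Nat.eq_zero_or_pos m with rfl | hpos
    · simp
    · have : (1 : ℝ) ≤ Real.sqrt m := Real.one_le_sqrt.2 (by exact_mod_cast hpos)
      nlinarith [Nat.cast_nonneg (α := ℝ) m]
  -- The constant is `4 * (4 * κ + 14)`: three shares cover the budget, and one covers the current
  -- or last search.
  have hs1 := mul_le_mul_of_nonneg_left hs (by linarith : 0 ≤ 4 * κ + 14)
  have hs2 := mul_le_mul_of_nonneg_left hm' (by linarith : 0 ≤ 4 * κ + 14)
  cases phase with
  | idle =>
    simp only [excess]
    have : 0 ≤ (4 * κ + 14) * (Real.sqrt m * m) := by positivity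
    linarith
  | stopped =>
    simp only [excess]
    linarith
  | searching σ =>
    obtain ⟨E', v, w, rfl, -, -, I⟩ := H.searching σ rfl
    have h1 : (σ.TF.card : ℝ) + 1 ≤ (E' ++ [(v, w)]).length := by
      rw [List.length_append, List.length_singleton]
      exact_mod_cast Nat.add_le_add_right I.card_TF_le 1
    have h2 := mul_le_mul_of_nonneg_left h1 (by linarith : 0 ≤ 4 * κ + 6)
    have h3 := σ.potential_nonneg hκ L
    simp only [excess]
    linarith [Nat.cast_nonneg (α := ℝ) (E' ++ [(v, w)]).length]

end Time

/-! ### Expected time. -/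

section Random

variable {V : Type*} [DecidableEq V]

theorem Step.length_arcs_le {c d : Config V} (h : Step c d) : c.arcs.length ≤ d.arcs.length := by
  cases h <;> simp

theorem Refill.arcs_eq {c : Config V} {G : Finset V} {next : V → Config V} (h : Refill c G next)
    (a : V) : (next a).arcs = c.arcs := by
  cases h <;> rfl

theorem RandomRun.length_arcs_le {c : Config V} {μ : PMF (Config V)} (h : RandomRun c μ) {m : ℕ}
    (hm : ∀ d ∈ μ.support, d.arcs.length ≤ m) : c.arcs.length ≤ m := by
  induction h with
  | refl c => exact hm c (by simp)
  | step c d μ h _ ih => exact h.length_arcs_le.trans (ih hm)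
  | refill c G hG next ν h _ ih =>
    obtain ⟨a, ha⟩ := id hG
    rw [← h.arcs_eq a]
    refine ih a ha fun d hd => hm d ?_
    rw [PMF.mem_support_bind_iff]
    exact ⟨a, (PMF.mem_support_uniformOfFinset_iff hG a).2 ha, hd⟩

theorem tsum_uniformOfFinset_bind {α β : Type*} {G : Finset α} (hG : G.Nonempty)
    (ν : α → PMF β) (g : β → ENNReal) :
    ∑' b, ((PMF.uniformOfFinset G hG).bind ν) b * g b
      = (G.card : ENNReal)⁻¹ * ∑ a ∈ G, ∑' b, ν a b * g b := by
  simp_rw [PMF.bind_apply, ← ENNReal.tsum_mul_right]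
  rw [ENNReal.tsum_comm]
  simp_rw [mul_assoc, ENNReal.tsum_mul_left]
  rw [tsum_eq_sum (s := G), Finset.mul_sum]
  · exact Finset.sum_congr rfl fun a ha => by rw [PMF.uniformOfFinset_apply_of_mem hG ha]
  · intro a ha
    rw [PMF.uniformOfFinset_apply_of_notMem hG ha, zero_mul]

/-- Induction from the start of the execution: the expected time is bounded by the current excess
plus a fixed total payment, and averaging over a refill does not raise this bound. -/
theorem RandomRun.tsum_time_le {c : Config V} {μ : PMF (Config V)} (h : RandomRun c μ)
    (H : Inv c) {m : ℕ} (hm : ∀ d ∈ μ.support, d.arcs.length ≤ m) :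
    ∑' d, μ d * (d.time : ENNReal) ≤ ENNReal.ofReal (excess 24 (max 1 (Real.sqrt m)) c
      + (16 * 24 + 56) * Real.sqrt m * m) := by
  induction h with
  | refl c =>
    rw [tsum_eq_single c (by intro d hd; simp [hd])]
    have := H.time_le (κ := 24) (by norm_num) (hm c (by simp))
    simpa using ENNReal.ofReal_le_ofReal this
  | step c d μ h _ ih =>
    refine (ih (H.step h) hm).trans (ENNReal.ofReal_le_ofReal ?_)
    gcongr
    exact h.excess_le H (by norm_num) (by positivity)
  | refill c G hG next ν h hν ih =>
    have hsupp : ∀ a ∈ G, ∀ d ∈ (ν a).support, d.arcs.length ≤ m := fun a ha d hd => by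
      refine hm d ?_
      rw [PMF.mem_support_bind_iff]
      exact ⟨a, (PMF.mem_support_uniformOfFinset_iff hG a).2 ha, hd⟩
    -- The excess may be negative, but with the total payment added it bounds a time; nonnegativity
    -- lets `ENNReal.ofReal` commute with the sum.
    have hnn : ∀ a ∈ G, 0 ≤ excess 24 (max 1 (Real.sqrt m)) (next a)
        + (16 * 24 + 56) * Real.sqrt m * m := fun a ha =>
      (Nat.cast_nonneg _).trans ((H.refill h ha).time_le (by norm_num)
        ((hν a ha).length_arcs_le (hsupp a ha)))
    have hg : (0 : ℝ) < G.card := by exact_mod_cast hG.card_pos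
    rw [tsum_uniformOfFinset_bind]
    calc (G.card : ENNReal)⁻¹ * ∑ a ∈ G, ∑' d, ν a d * (d.time : ENNReal)
        ≤ (G.card : ENNReal)⁻¹ * ∑ a ∈ G, ENNReal.ofReal
            (excess 24 (max 1 (Real.sqrt m)) (next a) + (16 * 24 + 56) * Real.sqrt m * m) := by
          gcongr with a ha
          exact ih a ha (H.refill h ha) (hsupp a ha)
      _ = ENNReal.ofReal ((G.card : ℝ)⁻¹ * ∑ a ∈ G,
            (excess 24 (max 1 (Real.sqrt m)) (next a) + (16 * 24 + 56) * Real.sqrt m * m)) := by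
          rw [← ENNReal.ofReal_sum_of_nonneg hnn, ENNReal.ofReal_mul (by positivity),
            ENNReal.ofReal_inv_of_pos hg, ENNReal.ofReal_natCast]
      _ ≤ _ := by
          refine ENNReal.ofReal_le_ofReal ?_
          rw [inv_mul_le_iff₀ hg, Finset.sum_add_distrib, Finset.sum_const, nsmul_eq_mul, mul_add]
          gcongr
          exact h.sum_excess_le H _

end Random

end IncTopo

open IncTopo in
theorem theorem3 :
    -- whatever soft thresholds are chosen, a search in progress can always be continued
    (∀ (V : Type u) [DecidableEq V] (L₀ : List V), L₀.Nodup → (∀ x : V, x ∈ L₀) →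
      ∀ (c : Config V) (σ : Search V), Run (fun _ _ _ => True) (Config.init L₀) c →
        c.phase = Phase.searching σ → CanContinue c) ∧
    -- approximate medians: worst-case bound
    (∀ ε : ℝ, 0 < ε → ∃ K : ℝ,
      ∀ (V : Type u) [DecidableEq V] (L₀ : List V), L₀.Nodup → (∀ x : V, x ∈ L₀) →
        ∀ c : Config V, Run (IsApproxMedian ε) (Config.init L₀) c →
          (c.time : ℝ) ≤ (K * Real.sqrt c.arcs.length) * c.arcs.length) ∧
    -- uniformly random soft thresholds: bound in expectation
    (∃ K : ℝ,
      ∀ (V : Type u) [DecidableEq V] (L₀ : List V), L₀.Nodup → (∀ x : V, x ∈ L₀) →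
        ∀ (μ : PMF (Config V)) (m : ℕ), RandomRun (Config.init L₀) μ →
          (∀ c ∈ μ.support, c.arcs.length ≤ m) →
            ∑' c, μ c * (c.time : ENNReal) ≤ ENNReal.ofReal ((K * Real.sqrt m) * m)) := by
  refine ⟨fun V _ L₀ hL hc c σ h hσ => (h.inv (.init hL hc)).canContinue hσ,
    fun ε hε => ⟨16 * (4 / ε) + 56, fun V _ L₀ hL hc c h => ?_⟩,
    16 * 24 + 56, fun V _ L₀ hL hc μ m h hm => ?_⟩
  · have h1 := (h.inv (.init hL hc)).time_le (κ := 4 / ε) (by positivity) le_rfl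
    -- The excess bound holds for every q > 0, so q may be chosen in hindsight from the final number
    -- of arcs.
    have h2 := h.excess_le hε (.init hL hc)
      (q := max 1 (Real.sqrt c.arcs.length)) (by positivity)
    rw [excess_init] at h2
    linarith
  · have := h.tsum_time_le (.init hL hc) hm
    rwa [excess_init, zero_add] at this
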